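/- Let $(X,\mu)$ be a $\sigma$-finite measure space and let $L$ be a (possibly unbounded) positive self-adjoint operator on the complex space $L^2(X)$. For $t>0$ let $e^{-tL}$ be the bounded operator on $L^2(X)$ given by the spectral theorem, and suppose that, for every $t>0$ and every $p\in[1,\infty)$, it extends continuously to a contraction of $L^p(X)$, that is, $\|e^{-tL}f\|_p\le\|f\|_p$ for all $f\in L^2(X)\cap L^p(X)$. Let $1\le p\le\infty$. We write $e^{-tL}$ also for the continuous extension of this operator to $L^p(X)$ (when $p=\infty$, the weak-$*$ continuous extension). For $f\in L^p(X)$ and $s>0$ put $$A^sf=\frac1s\int_0^s e^{-tL}f\,dt ,\qquad A^*f=\sup_{s>0}|A^sf| ,$$ and for a function $h:[0,\infty)\to\mathbb C$ put $$\tilde h(L)f=\int_0^\infty h(t)\,e^{-tL}f\,dt .$$ Here the integrals of $L^p(X)$-valued functions are taken in the weak sense, against all functions in $L^q(X)$ with $\frac1p+\frac1q=1$, and the supremum of a family of nonnegative measurable functions is its least upper bound, with values in $[0,\infty]$, for the order "$\le$ almost everywhere" among measurable functions modulo equality almost everywhere. For a constant $C\ge0$, let $\mathcal H_C$ be the set of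 all continuously differentiable functions $h:[0,\infty)\to\mathbb C$ such that $$\lim_{t\to0+}|t\,h(t)|=\lim_{t\to+\infty}|t\,h(t)|=0\qquad\text{and}\qquad\int_0^\infty|t\,h'(t)|\,dt\le C .$$ **Theorem.** The extensions of the operators $e^{-tL}$ to $L^p(X)$ exist, and for every $f\in L^p(X)$ the integrals defining $A^sf$ ($s>0$) and $\tilde h(L)f$ ($h\in\mathcal H_C$) exist as elements of $L^p(X)$. Moreover, for every $f\in L^p(X)$ and every $h\in\mathcal H_C$, $$|\tilde h(L)f|\le C\,A^*f\qquad\text{almost everywhere on }X,$$ and consequently $$\sup\{|\tilde h(L)f|:h\in\mathcal H_C\}\le C\,A^*f\qquad\text{almost everywhere on }X.$$ -/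

import Mathlib

open MeasureTheory Filter Topology Set
open scoped ENNReal NNReal

noncomputable section

/-! ### Functions of a positive self-adjoint operator -/

section Hilbert

variable {E : Type*} [NormedAddCommGroup E] [InnerProductSpace ℂ E] [CompleteSpace E]

/-- A (possibly unbounded) operator is positive self-adjoint if it is self-adjoint (so in particular
densely defined) and `⟨x, L x⟩ ≥ 0` for all `x` in its domain. -/
structure IsPosSelfAdjoint (L : E →ₗ.[ℂ] E) : Prop where
  selfAdjoint : IsSelfAdjoint L
  nonneg : ∀ x : L.domain, 0 ≤ (inner ℂ (x : E) (L x)).re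

/-- `R` is the resolvent `(1 + L)⁻¹`. -/
def IsResolvent (L : E →ₗ.[ℂ] E) (R : E →L[ℂ] E) : Prop :=
  (∀ y : E, ∃ h : R y ∈ L.domain, R y + L ⟨R y, h⟩ = y) ∧
    ∀ x : L.domain, R ((x : E) + L x) = x

theorem IsPosSelfAdjoint.norm_bounds {L : E →ₗ.[ℂ] E} (hL : IsPosSelfAdjoint L) (x : L.domain) :
    ‖(x : E)‖ ≤ ‖(x : E) + L x‖ ∧ ‖L x‖ ≤ ‖(x : E) + L x‖ := by
  have h1 := @norm_add_sq ℂ E _ _ _ (x : E) (L x)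
  have h2 := hL.nonneg x
  have h3 : RCLike.re (inner ℂ (x : E) (L x)) = (inner ℂ (x : E) (L x)).re := rfl
  rw [h3] at h1
  constructor <;> refine abs_le_of_sq_le_sq' ?_ (norm_nonneg _) |>.2
  · nlinarith [sq_nonneg ‖L x‖]
  · nlinarith [sq_nonneg ‖(x : E)‖]

theorem IsPosSelfAdjoint.surjective {L : E →ₗ.[ℂ] E} (hL : IsPosSelfAdjoint L) (y : E) :
    ∃ x : L.domain, (x : E) + L x = y := by
  let T : L.domain →ₗ[ℂ] E := L.domain.subtype + L.toFun
  have hT : ∀ x : L.domain, T x = (x : E) + L x := fun x => rfl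
  have hclosed : IsClosed (LinearMap.range T : Set E) := by
    let Φ : L.graph → E := fun g => (g : E × E).1 + (g : E × E).2
    have hg : IsClosed (L.graph : Set (E × E)) := hL.selfAdjoint.isClosed
    have : CompleteSpace L.graph := hg.completeSpace_coe
    have hanti : AntilipschitzWith 1 Φ := by
      refine AntilipschitzWith.of_le_mul_dist fun a b => ?_
      obtain ⟨x, hx1, hx2⟩ := (LinearPMap.mem_graph_iff L).1 (a - b).2
      have hb := hL.norm_bounds x
      have e : Φ a - Φ b = (x : E) + L x := by
        rw [hx1, hx2]
        simp only [Φ, Submodule.coe_sub, Prod.fst_sub, Prod.snd_sub]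
        abel
      rw [dist_eq_norm, dist_eq_norm, e, NNReal.coe_one, one_mul]
      change ‖((a - b : L.graph) : E × E)‖ ≤ _
      rw [Prod.norm_def, ← hx1, ← hx2]
      exact max_le hb.1 hb.2
    have huc : UniformContinuous Φ :=
      (uniformContinuous_fst.comp uniformContinuous_subtype_val).add
        (uniformContinuous_snd.comp uniformContinuous_subtype_val)
    have h := hanti.isClosed_range huc
    convert h using 1
    ext z
    constructor
    · rintro ⟨x, rfl⟩
      exact ⟨⟨((x : E), L x), L.mem_graph x⟩, rfl⟩
    · rintro ⟨g, rfl⟩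
      obtain ⟨x, hx1, hx2⟩ := (LinearPMap.mem_graph_iff L).1 g.2
      exact ⟨x, by simp only [Φ, ← hx1, ← hx2]; rfl⟩
  have horth : (LinearMap.range T)ᗮ = ⊥ := by
    rw [Submodule.eq_bot_iff]
    intro v hv
    have hv' : ∀ x : L.domain, inner ℂ (-v) (x : E) = inner ℂ v (L x) := by
      intro x
      have := (Submodule.mem_orthogonal' _ v).1 hv (T x) ⟨x, rfl⟩
      rw [hT, inner_add_right] at this
      rw [inner_neg_left]
      linear_combination -this
    have hd := hL.selfAdjoint.dense_domain
    have hmem : v ∈ L.adjoint.domain := LinearPMap.mem_adjoint_domain_of_exists v ⟨-v, hv'⟩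
    have happ : L.adjoint ⟨v, hmem⟩ = -v := LinearPMap.adjoint_apply_eq hd ⟨v, hmem⟩ hv'
    have hg : (v, -v) ∈ L.graph := by
      have h1 : (v, -v) ∈ L.adjoint.graph := happ ▸ L.adjoint.mem_graph ⟨v, hmem⟩
      rwa [LinearPMap.isSelfAdjoint_def.1 hL.selfAdjoint] at h1
    obtain ⟨x, hx1, hx2⟩ := (LinearPMap.mem_graph_iff L).1 hg
    have hb := (hL.norm_bounds x).1
    simp only at hx1 hx2
    rw [hx2, hx1] at hb
    simpa using hb
  have htop : LinearMap.range T = ⊤ := by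
    rw [← hclosed.submodule_topologicalClosure_eq, Submodule.topologicalClosure_eq_top_iff, horth]
  obtain ⟨x, hx⟩ := LinearMap.range_eq_top.1 htop y
  exact ⟨x, hx⟩

theorem IsPosSelfAdjoint.exists_resolvent {L : E →ₗ.[ℂ] E} (hL : IsPosSelfAdjoint L) :
    ∃ R : E →L[ℂ] E, IsResolvent L R := by
  choose r hr using hL.surjective
  have hinj : ∀ x x' : L.domain, (x : E) + L x = (x' : E) + L x' → x = x' := by
    intro x x' h
    have hb := (hL.norm_bounds (x - x')).1
    have e : ((x - x' : L.domain) : E) + L (x - x') = 0 := by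
      rw [LinearPMap.map_sub, Submodule.coe_sub]
      rw [← sub_eq_zero] at h
      rw [← h]; abel
    rw [e, norm_zero] at hb
    exact sub_eq_zero.1 (Subtype.ext (norm_le_zero_iff.1 hb))
  let R₀ : E →ₗ[ℂ] E :=
    { toFun := fun y => (r y : E)
      map_add' := fun y z => by
        have : r (y + z) = r y + r z := hinj _ _ (by
          rw [hr, LinearPMap.map_add, Submodule.coe_add]
          nth_rewrite 1 [← hr y, ← hr z]
          abel)
        rw [this, Submodule.coe_add]
      map_smul' := fun c y => by
        have : r (c • y) = c • r y := hinj _ _ (by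
          rw [hr, LinearPMap.map_smul, Submodule.coe_smul, ← smul_add, hr])
        rw [this, Submodule.coe_smul, RingHom.id_apply] }
  refine ⟨R₀.mkContinuous 1 fun y => ?_, fun y => ⟨(r y).2, hr y⟩, fun x => ?_⟩
  · have := (hL.norm_bounds (r y)).1
    rw [hr y] at this
    rw [one_mul]
    exact this
  · change ((r ((x : E) + L x) : L.domain) : E) = x
    rw [hinj _ _ (hr ((x : E) + L x))]

/-- The resolvent `(1 + L)⁻¹` of a positive self-adjoint operator. -/
def posResolvent (L : E →ₗ.[ℂ] E) (hL : IsPosSelfAdjoint L) : E →L[ℂ] E :=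
  hL.exists_resolvent.choose

/-- The operator `exp (-t L)`, `t > 0`, given by the spectral theorem. If `R = (1 + L)⁻¹`, which is
a bounded self-adjoint operator with spectrum in `[0, 1]`, then `L = 1 / R - 1`, and so
`exp (-t L) = φ (R)` where `φ (r) = exp (-t (1 / r - 1))` for `r > 0` and `φ (0) = 0`; the function
`φ` is continuous on `[0, 1]`. -/
def expNeg (L : E →ₗ.[ℂ] E) (hL : IsPosSelfAdjoint L) (t : ℝ) : E →L[ℂ] E :=
  cfc (fun r : ℝ => if 0 < r then Real.exp (-(t * (1 / r - 1))) else 0) (posResolvent L hL)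

end Hilbert

/-! ### Least upper bounds in the ordered space of classes of measurable functions -/

section Sup

variable {X : Type*} [MeasurableSpace X] {μ : Measure X}

theorem exists_isLUB_aeEqFun [SigmaFinite μ] (S : Set (X →ₘ[μ] ℝ≥0∞)) : ∃ g, IsLUB S g := by
  rcases S.eq_empty_or_nonempty with rfl | hS
  · refine ⟨AEEqFun.const X 0, by simp, fun g _ => ?_⟩
    rw [← AEEqFun.coeFn_le]
    filter_upwards [AEEqFun.coeFn_const X (0 : ℝ≥0∞) (μ := μ)] with x hx
    rw [hx]
    exact zero_le
  have : Nonempty S := hS.to_subtype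
  let φ : ℝ≥0∞ → ℝ≥0∞ := fun x => (x⁻¹ + 1)⁻¹
  have hφmono : StrictMono φ := fun a b hab =>
    ENNReal.inv_lt_inv.2 (ENNReal.add_lt_add_right ENNReal.one_ne_top (ENNReal.inv_lt_inv.2 hab))
  have hφ1 : ∀ a, φ a ≤ 1 := fun a => ENNReal.inv_le_one.2 le_add_self
  have hφm : Measurable φ := hφmono.monotone.measurable
  let ν : Measure X := μ.toFinite
  have hae : ∀ {P : X → Prop}, (∀ᵐ x ∂ν, P x) ↔ ∀ᵐ x ∂μ, P x := by
    intro P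
    simp only [ν, ae_toFinite]
  let G : (ℕ → S) → X → ℝ≥0∞ := fun u x => ⨆ n, ((u n : X →ₘ[μ] ℝ≥0∞) : X → ℝ≥0∞) x
  have hGm : ∀ u, Measurable (G u) := fun u =>
    Measurable.iSup fun n => (u n : X →ₘ[μ] ℝ≥0∞).measurable
  let J : (ℕ → S) → ℝ≥0∞ := fun u => ∫⁻ x, φ (G u x) ∂ν
  have hJ : ∀ u, J u ≤ ν univ := fun u => by
    calc J u ≤ ∫⁻ _, 1 ∂ν := lintegral_mono fun x => hφ1 _
      _ = ν univ := by simp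
  obtain ⟨w, -, hw, hwmem⟩ := exists_seq_tendsto_sSup
    (range_nonempty J) (OrderTop.bddAbove _)
  choose U hU using hwmem
  let u : ℕ → S := fun k => U k.unpair.1 k.unpair.2
  have hle : ∀ n x, G (U n) x ≤ G u x := fun n x => iSup_le fun m => by
    refine le_iSup_of_le (Nat.pair n m) ?_
    simp only [u, Nat.unpair_pair]
    exact le_rfl
  have hmax : ∀ v, J v ≤ J u := by
    intro v
    refine (le_sSup (mem_range_self v)).trans (le_of_tendsto' hw fun n => ?_)
    rw [← hU n]
    exact lintegral_mono fun x => hφmono.monotone (hle n x)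
  refine ⟨AEEqFun.mk (G u) (hGm u).aestronglyMeasurable, fun f hf => ?_, fun g hg => ?_⟩
  · let v : ℕ → S := fun n => Nat.casesOn n ⟨f, hf⟩ u
    have hGle : ∀ (v : ℕ → S) (n : ℕ) (x : X), ((v n : X →ₘ[μ] ℝ≥0∞) : X → ℝ≥0∞) x ≤ G v x :=
      fun v n x => le_iSup (fun n => ((v n : X →ₘ[μ] ℝ≥0∞) : X → ℝ≥0∞) x) n
    have huv : ∀ x, G u x ≤ G v x := fun x => iSup_le fun n => hGle v (n + 1) x
    have hfin : J u ≠ ∞ := ne_top_of_le_ne_top (measure_ne_top ν univ) (hJ u)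
    have heq := ae_eq_of_ae_le_of_lintegral_le
      (ae_of_all ν fun x => hφmono.monotone (huv x)) hfin
      (hφm.comp (hGm v)).aemeasurable (hmax v)
    rw [← AEEqFun.coeFn_le]
    filter_upwards [hae.1 heq, AEEqFun.coeFn_mk (G u) (hGm u).aestronglyMeasurable] with x hx hx'
    rw [hx', hφmono.injective hx]
    exact hGle v 0 x
  · rw [← AEEqFun.coeFn_le]
    have h : ∀ n, ((u n : X →ₘ[μ] ℝ≥0∞) : X → ℝ≥0∞) ≤ᵐ[μ] g := fun n =>
      AEEqFun.coeFn_le.2 (hg (u n).2)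
    filter_upwards [ae_all_iff.2 h, AEEqFun.coeFn_mk (G u) (hGm u).aestronglyMeasurable]
      with x hx hx'
    rw [hx']
    exact iSup_le hx

/-- The supremum of a set of (classes modulo equality almost everywhere of) measurable functions
with values in `[0, ∞]`: its least upper bound for the order "`f ≤ g` almost everywhere". -/
def aeSup [SigmaFinite μ] (S : Set (X →ₘ[μ] ℝ≥0∞)) : X →ₘ[μ] ℝ≥0∞ :=
  (exists_isLUB_aeEqFun S).choose

/-- The class of the function `x ↦ |f x|`, with values in `[0, ∞]`. -/
def absClass {p : ℝ≥0∞} (f : Lp ℂ p μ) : X →ₘ[μ] ℝ≥0∞ :=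
  AEEqFun.comp (fun z : ℂ => ‖z‖ₑ) continuous_enorm (f : X →ₘ[μ] ℂ)

end Sup

/-! ### Semigroups and integrals of semigroups on `L^p` -/

section Lp

variable {X : Type*} [MeasurableSpace X] {μ : Measure X}

/-- `S` is the continuous extension to `L^p` of the operator `T` on `L^2`: it is a bounded operator
on `L^p` that agrees with `T` on `L^2 ∩ L^p`, and when `p = ∞`, where `L^2 ∩ L^p` is only weak-star
dense, it is moreover continuous for the weak-star topology `σ(L^∞, L^1)`, that is, for every
`g ∈ L^1` the functional `f ↦ ∫ (S f) g` is again given by a function in `L^1`. -/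
def IsLpExtension (T : Lp ℂ 2 μ →L[ℂ] Lp ℂ 2 μ) (p : ℝ≥0∞) [Fact (1 ≤ p)]
    (S : Lp ℂ p μ →L[ℂ] Lp ℂ p μ) : Prop :=
  (∀ (f : Lp ℂ 2 μ) (g : Lp ℂ p μ), f =ᵐ[μ] g → T f =ᵐ[μ] S g) ∧
    (p = ∞ → ∀ g : X → ℂ, MemLp g 1 μ → ∃ g' : X → ℂ, MemLp g' 1 μ ∧
      ∀ f : Lp ℂ p μ, ∫ x, S f x * g x ∂μ = ∫ x, f x * g' x ∂μ)

open scoped Classical in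
/-- The continuous extension of `T` to `L^p` (`0` if there is none). -/
def lpExtension (T : Lp ℂ 2 μ →L[ℂ] Lp ℂ 2 μ) (p : ℝ≥0∞) [Fact (1 ≤ p)] :
    Lp ℂ p μ →L[ℂ] Lp ℂ p μ :=
  if h : ∃ S, IsLpExtension T p S then h.choose else 0

/-- `u = ∫ G(t) dν(t)` in `L^p`, where the integral is taken in the weak sense, that is,
`∫ u ψ dμ = ∫ (∫ G(t) ψ dμ) dν(t)`, the integrals being absolutely convergent, for all `ψ ∈ L^q`,
where `q` is the conjugate exponent. -/
def HasWeakIntegral {p : ℝ≥0∞} (ν : Measure ℝ) (G : ℝ → Lp ℂ p μ) (u : Lp ℂ p μ) : Prop :=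
  ∀ (q : ℝ≥0∞) (_ : p.HolderConjugate q) (ψ : X → ℂ), MemLp ψ q μ →
    Integrable (fun t => ∫ x, G t x * ψ x ∂μ) ν ∧
      ∫ x, u x * ψ x ∂μ = ∫ t, ∫ x, G t x * ψ x ∂μ ∂ν

open scoped Classical in
/-- The weak integral `∫ G(t) dν(t)` in `L^p` (`0` if it does not exist). -/
def weakIntegral {p : ℝ≥0∞} (ν : Measure ℝ) (G : ℝ → Lp ℂ p μ) : Lp ℂ p μ :=
  if h : ∃ u, HasWeakIntegral ν G u then h.choose else 0

variable (L : Lp ℂ 2 μ →ₗ.[ℂ] Lp ℂ 2 μ) (hL : IsPosSelfAdjoint L)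

/-- The operators `exp (-t L)` extend continuously from `L^2` to contractions of `L^p` for all
`p ∈ [1, ∞)`. -/
def IsLpContractive : Prop :=
  ∀ t : ℝ, 0 < t → ∀ p : ℝ≥0∞, 1 ≤ p → p ≠ ∞ → ∀ f : Lp ℂ 2 μ,
    eLpNorm (expNeg L hL t f) p μ ≤ eLpNorm f p μ

variable {p : ℝ≥0∞} [Fact (1 ≤ p)]

/-- The operator `exp (-t L)` on `L^p`. -/
def heatLp (p : ℝ≥0∞) [Fact (1 ≤ p)] (t : ℝ) : Lp ℂ p μ →L[ℂ] Lp ℂ p μ :=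
  lpExtension (expNeg L hL t) p

/-- The average `A^s f = (1 / s) ∫_0^s exp (-t L) f dt`. -/
def semigroupAverage (s : ℝ) (f : Lp ℂ p μ) : Lp ℂ p μ :=
  ((1 / s : ℝ) : ℂ) • weakIntegral (volume.restrict (Ioc 0 s)) (fun t => heatLp L hL p t f)

/-- The maximal function `A^* f = sup_{s > 0} |A^s f|`. -/
def maximalFunction [SigmaFinite μ] (f : Lp ℂ p μ) : X →ₘ[μ] ℝ≥0∞ :=
  aeSup {g | ∃ s : ℝ, 0 < s ∧ g = absClass (semigroupAverage L hL s f)}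

/-- `h~(L) f = ∫_0^∞ h(t) exp (-t L) f dt`. -/
def laplaceOp (h : ℝ → ℂ) (f : Lp ℂ p μ) : Lp ℂ p μ :=
  weakIntegral (volume.restrict (Ioi 0)) (fun t => h t • heatLp L hL p t f)

end Lp

/-- The family of continuously differentiable functions `h` on `[0, ∞)` such that `|t h(t)| → 0` as
`t → 0+` and as `t → ∞`, and `∫_0^∞ |t h'(t)| dt ≤ C`. (The values `h t` for `t < 0` are
irrelevant.) -/
structure LaplaceClass (C : ℝ≥0) (h : ℝ → ℂ) : Prop where
  contDiffOn : ContDiffOn ℝ 1 h (Ici 0)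
  tendsto_zero : Tendsto (fun t : ℝ => ‖(t : ℂ) * h t‖) (𝓝[>] 0) (𝓝 0)
  tendsto_atTop : Tendsto (fun t : ℝ => ‖(t : ℂ) * h t‖) atTop (𝓝 0)
  integral_le : ∫⁻ t in Ioi (0 : ℝ), ‖(t : ℂ) * derivWithin h (Ici 0) t‖ₑ ≤ C

end

/-! The inequality is an integration by parts. Since `t h(t) → 0` at infinity, `h(t) = -∫_t^∞ h'(s)
ds`. Inserting this into `h~(L) f` and exchanging the integrals gives `h~(L) f = -∫_0^∞ h'(s) ∫_0^s
e^{-tL} f dt ds = -∫_0^∞ s h'(s) A^s f ds`. Each `|A^s f|` is at most `A^* f`, and `∫ |s h'(s)| ds ≤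
C`. The exchange is `LaplaceClass.integral_mul_eq`. It is applied to the scalar function `t ↦ ∫
(e^{-tL} f) ψ dμ`, and `ae_enorm_le_of_forall_integral_mul_le` turns the estimate for all test
functions `ψ` into one almost everywhere.

Most of the work is existence. For `p < ∞` an operator extends from `L^2 ∩ L^p` by density. For `p =
∞` the extension is the transpose of an extension to `L^1`, which uses self-adjointness and the
duality of `L^1` and `L^∞` (`exists_Linfty_of_dual_L1`, deduced from the Riesz theorem in `L^2`).

For the weak integrals, `t ↦ e^{-tL}` is norm continuous on `L^2` for `t > 0`, so `H = ∫ k(t)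
e^{-tL} dt` is a Bochner integral of operators. `H` is again bounded in every `L^p`-norm
(`IsContractionFamily.isLpBounded_integral`), hence extends to `L^p`. Its extension applied to `f`
is the weak integral, as one sees by truncating both `f` and `ψ` into `L^2`
(`IsContractionFamily.exists_integral_mul`). -/

/-! ### Truncation along an integrable weight -/

section Truncation

section Pointwise

variable {X : Type*} {w : X → ℝ}

/-- The truncation of `f` to the set where `|f| ≤ n w`. -/
noncomputable def weightTrunc (w : X → ℝ) (n : ℕ) (f : X → ℂ) : X → ℂ :=
  {x | ‖f x‖ ≤ n * w x}.indicator f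

theorem norm_weightTrunc_le (w : X → ℝ) (n : ℕ) (f : X → ℂ) (x : X) :
    ‖weightTrunc w n f x‖ ≤ ‖f x‖ :=
  norm_indicator_le_norm_self _ _

theorem norm_weightTrunc_le_weight (hw : ∀ x, 0 < w x) (n : ℕ) (f : X → ℂ) (x : X) :
    ‖weightTrunc w n f x‖ ≤ n * w x := by
  unfold weightTrunc
  by_cases h : x ∈ {x | ‖f x‖ ≤ n * w x}
  · rw [indicator_of_mem h]; exact h
  · rw [indicator_of_notMem h, norm_zero]
    have := hw x
    positivity

theorem tendsto_weightTrunc (hw : ∀ x, 0 < w x) (f : X → ℂ) (x : X) :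
    Tendsto (fun n => weightTrunc w n f x) atTop (𝓝 (f x)) := by
  obtain ⟨N, hN⟩ := exists_nat_ge (‖f x‖ / w x)
  -- As `w x > 0`, the sequence is eventually constant.
  refine tendsto_const_nhds.congr' ?_
  filter_upwards [eventually_ge_atTop N] with n hn
  refine (indicator_of_mem (s := {x | ‖f x‖ ≤ n * w x}) ?_ f).symm
  have : (N : ℝ) ≤ n := by exact_mod_cast hn
  exact (div_le_iff₀ (hw x)).1 (hN.trans this)

end Pointwise

variable {X : Type*} [MeasurableSpace X] {μ : Measure X}

/-- A positive weight that lies in all the spaces `L^r`, `1 ≤ r ≤ ∞`. -/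
structure IsLpWeight (μ : Measure X) (w : X → ℝ) : Prop where
  measurable : Measurable w
  pos : ∀ x, 0 < w x
  le_one : ∀ x, w x ≤ 1
  memLp : ∀ r : ℝ≥0∞, 1 ≤ r → MemLp w r μ

/-- Take `w = min g 1` with `g` positive and integrable; then `w^r ≤ w ≤ g` for every finite `r ≥
1`. -/
theorem exists_isLpWeight (μ : Measure X) [SigmaFinite μ] : ∃ w : X → ℝ, IsLpWeight μ w := by
  obtain ⟨g, hg, hgm, hgi⟩ := exists_pos_lintegral_lt_of_sigmaFinite μ one_ne_zero
  have hm : Measurable fun x => ((min (g x) 1 : ℝ≥0) : ℝ) :=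
    measurable_coe_nnreal_real.comp (hgm.min measurable_const)
  refine ⟨fun x => (min (g x) 1 : ℝ≥0), hm, fun x => ?_, fun x => ?_, fun r hr => ?_⟩
  · exact NNReal.coe_pos.2 (lt_min (hg x) one_pos)
  · exact_mod_cast min_le_right (g x) 1
  · refine ⟨hm.aestronglyMeasurable, ?_⟩
    rcases eq_or_ne r ∞ with rfl | hr'
    · refine (memLp_top_of_bound hm.aestronglyMeasurable 1 (ae_of_all _ fun x => ?_)).2
      rw [Real.norm_of_nonneg (NNReal.coe_nonneg _)]
      exact_mod_cast min_le_right (g x) 1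
    · have hr0 : r ≠ 0 := (one_pos.trans_le hr).ne'
      have hr1 : 1 ≤ r.toReal := by
        simpa using ENNReal.toReal_mono hr' hr
      rw [eLpNorm_lt_top_iff_lintegral_rpow_enorm_lt_top hr0 hr']
      refine lt_of_le_of_lt (lintegral_mono fun x => ?_) (hgi.trans ENNReal.one_lt_top)
      have h1 : ‖((min (g x) 1 : ℝ≥0) : ℝ)‖ₑ = ((min (g x) 1 : ℝ≥0) : ℝ≥0∞) := by
        rw [enorm_eq_nnnorm, NNReal.nnnorm_eq]
      rw [h1]
      refine (ENNReal.rpow_le_rpow_of_exponent_ge ?_ hr1).trans ?_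
      · exact_mod_cast min_le_right (g x) 1
      · rw [ENNReal.rpow_one]
        exact_mod_cast min_le_left (g x) 1

variable {w : X → ℝ} {f : X → ℂ}

theorem MeasureTheory.AEStronglyMeasurable.weightTrunc (hf : AEStronglyMeasurable f μ)
    (hw : Measurable w) (n : ℕ) : AEStronglyMeasurable (weightTrunc w n f) μ :=
  hf.indicator₀ (nullMeasurableSet_le hf.norm (hw.const_mul _).aestronglyMeasurable)

theorem IsLpWeight.memLp_of_le (hw : IsLpWeight μ w) (hf : AEStronglyMeasurable f μ) (c : ℝ)
    (h : ∀ x, ‖f x‖ ≤ c * w x) {r : ℝ≥0∞} (hr : 1 ≤ r) : MemLp f r μ :=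
  ((hw.memLp r hr).const_mul c).mono hf (ae_of_all _ fun x => (h x).trans (le_abs_self _))

theorem IsLpWeight.memLp_weightTrunc (hw : IsLpWeight μ w) (hf : AEStronglyMeasurable f μ) (n : ℕ)
    {r : ℝ≥0∞} (hr : 1 ≤ r) : MemLp (weightTrunc w n f) r μ :=
  hw.memLp_of_le (hf.weightTrunc hw.measurable n) n (norm_weightTrunc_le_weight hw.pos n f) hr

theorem tendsto_integral_weightTrunc_mul (hw : Measurable w) (hw' : ∀ x, 0 < w x)
    (hf : AEStronglyMeasurable f μ) {ψ : X → ℂ} (hψ : AEStronglyMeasurable ψ μ)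
    (h : Integrable (fun x => f x * ψ x) μ) :
    Tendsto (fun n => ∫ x, weightTrunc w n f x * ψ x ∂μ) atTop (𝓝 (∫ x, f x * ψ x ∂μ)) := by
  refine tendsto_integral_of_dominated_convergence (fun x => ‖f x * ψ x‖)
    (fun n => (hf.weightTrunc hw n).mul hψ) h.norm (fun n => ae_of_all _ fun x => ?_)
    (ae_of_all _ fun x => (tendsto_weightTrunc hw' f x).mul_const _)
  rw [norm_mul, norm_mul]
  exact mul_le_mul_of_nonneg_right (norm_weightTrunc_le w n f x) (norm_nonneg _)

theorem tendsto_eLpNorm_weightTrunc_sub (hw : Measurable w) (hw' : ∀ x, 0 < w x) {p : ℝ≥0∞}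
    (hp : 1 ≤ p) (hp' : p ≠ ∞) (hf : MemLp f p μ) :
    Tendsto (fun n => eLpNorm (weightTrunc w n f - f) p μ) atTop (𝓝 0) := by
  have hp0 : p ≠ 0 := (one_pos.trans_le hp).ne'
  have hpos : 0 < p.toReal := ENNReal.toReal_pos hp0 hp'
  have key : Tendsto (fun n => ∫⁻ x, ‖(weightTrunc w n f - f) x‖ₑ ^ p.toReal ∂μ) atTop (𝓝 0) := by
    have := tendsto_lintegral_of_dominated_convergence' (μ := μ)
      (F := fun n x => ‖(weightTrunc w n f - f) x‖ₑ ^ p.toReal) (f := fun _ => 0)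
      (fun x => ‖f x‖ₑ ^ p.toReal)
      (fun n => ((hf.1.weightTrunc hw n).sub hf.1).enorm.pow_const _)
      (fun n => ae_of_all _ fun x => ?_)
      ((eLpNorm_lt_top_iff_lintegral_rpow_enorm_lt_top hp0 hp').1 hf.2).ne
      (ae_of_all _ fun x => ?_)
    · simpa using this
    · refine ENNReal.rpow_le_rpow ?_ hpos.le
      unfold weightTrunc
      by_cases h : x ∈ {x | ‖f x‖ ≤ n * w x}
      · rw [Pi.sub_apply, indicator_of_mem h]; simp
      · rw [Pi.sub_apply, indicator_of_notMem h]; simp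
    · have h1 : Tendsto (fun n => (weightTrunc w n f - f) x) atTop (𝓝 0) := by
        simpa using (tendsto_weightTrunc hw' f x).sub_const (f x)
      have h2 := (ENNReal.continuous_rpow_const (y := p.toReal)).tendsto _ |>.comp h1.enorm
      simpa [Function.comp_def, hpos] using h2
  simp_rw [eLpNorm_eq_lintegral_rpow_enorm_toReal hp0 hp']
  have h2 := (ENNReal.continuous_rpow_const (y := 1 / p.toReal)).tendsto _ |>.comp key
  simpa [Function.comp_def, hpos] using h2

theorem MeasureTheory.MemLp.integrableOn_of_measure_lt_top {p : ℝ≥0∞} (hp : 1 ≤ p)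
    (hf : MemLp f p μ) {s : Set X} (hs : μ s < ∞) : IntegrableOn f s μ := by
  have : IsFiniteMeasure (μ.restrict s) := ⟨by simpa using hs⟩
  exact memLp_one_iff_integrable.1 ((hf.restrict s).mono_exponent hp)

/-- A function is dominated by `v` almost everywhere if it is so when paired with all test
functions. -/
theorem ae_enorm_le_of_forall_integral_mul_le [SigmaFinite μ] {u : X → ℂ}
    (hum : AEStronglyMeasurable u μ) (hu : ∀ s, MeasurableSet s → μ s < ∞ → IntegrableOn u s μ)
    {v : X → ℝ≥0∞}
    (h : ∀ ψ : X → ℂ, (∀ r : ℝ≥0∞, 1 ≤ r → MemLp ψ r μ) →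
      ‖∫ x, u x * ψ x ∂μ‖ₑ ≤ ∫⁻ x, v x * ‖ψ x‖ₑ ∂μ) :
    ∀ᵐ x ∂μ, ‖u x‖ₑ ≤ v x := by
  refine ae_le_of_forall_setLIntegral_le_of_sigmaFinite₀ hum.enorm fun B hB hμB => ?_
  -- `σ` is the conjugate phase of `u`, so `u σ = |u|`, and it vanishes where `u` does. The test
  -- function is `σ` cut off to `B`.
  let σ : X → ℂ := fun x => star (u x) * ((‖u x‖⁻¹ : ℝ) : ℂ)
  have hσm : AEStronglyMeasurable σ μ :=
    hum.star.mul (Complex.continuous_ofReal.comp_aestronglyMeasurable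
      (hum.norm.aemeasurable.inv.aestronglyMeasurable))
  have hσ1 : ∀ x, ‖σ x‖ ≤ 1 := fun x => by
    simp only [σ, norm_mul, norm_star, Complex.norm_real, norm_inv, norm_norm]
    exact mul_inv_le_one
  have huσ : ∀ x, u x * σ x = (‖u x‖ : ℂ) := fun x => by
    by_cases h0 : u x = 0
    · simp [h0]
    · have h1 : (‖u x‖ : ℂ) ≠ 0 := by simpa using h0
      simp only [σ, ← mul_assoc, Complex.star_def, Complex.mul_conj']
      push_cast
      field_simp
  have hψ : ∀ r : ℝ≥0∞, 1 ≤ r → MemLp (B.indicator σ) r μ := fun r hr => by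
    refine ((memLp_indicator_const r hB (1 : ℝ) (Or.inr hμB.ne))).mono (hσm.indicator hB)
      (ae_of_all _ fun x => ?_)
    by_cases hx : x ∈ B
    · simpa [hx] using hσ1 x
    · simp [hx]
  have h1 := h _ hψ
  have hint : IntegrableOn u B μ := hu B hB hμB
  have h2 : ∫ x, u x * B.indicator σ x ∂μ = ((∫ x in B, ‖u x‖ ∂μ : ℝ) : ℂ) := by
    rw [← integral_complex_ofReal, ← integral_indicator hB]
    refine integral_congr_ae (ae_of_all _ fun x => ?_)
    by_cases hx : x ∈ B
    · simp [hx, huσ]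
    · simp [hx]
  have h3 : ‖((∫ x in B, ‖u x‖ ∂μ : ℝ) : ℂ)‖ₑ = ∫⁻ x in B, ‖u x‖ₑ ∂μ := by
    rw [← ofReal_norm, Complex.norm_real,
      Real.norm_of_nonneg (integral_nonneg fun _ => norm_nonneg _),
      ofReal_integral_norm_eq_lintegral_enorm hint]
  rw [h2, h3] at h1
  refine h1.trans ?_
  rw [← lintegral_indicator hB]
  refine lintegral_mono fun x => ?_
  by_cases hx : x ∈ B
  · simp only [hx, indicator_of_mem]
    refine mul_le_of_le_one_right' ?_
    rw [← ofReal_norm]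
    exact ENNReal.ofReal_le_one.2 (hσ1 x)
  · simp [hx]

/-- The previous lemma is applied to `u - v` with bound `0`. Two exponents are allowed so that a
function in `L^2` can be identified with one in `L^∞`. -/
theorem ae_eq_of_forall_integral_mul_eq [SigmaFinite μ] {p q : ℝ≥0∞} (hp : 1 ≤ p) (hq : 1 ≤ q)
    {u v : X → ℂ} (hu : MemLp u p μ) (hv : MemLp v q μ)
    (h : ∀ ψ : X → ℂ, (∀ r : ℝ≥0∞, 1 ≤ r → MemLp ψ r μ) →
      ∫ x, u x * ψ x ∂μ = ∫ x, v x * ψ x ∂μ) : u =ᵐ[μ] v := by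
  have := ae_enorm_le_of_forall_integral_mul_le (hu.1.sub hv.1) (fun s _ hs =>
    (hu.integrableOn_of_measure_lt_top hp hs).sub (hv.integrableOn_of_measure_lt_top hq hs))
    (v := 0) fun ψ hψ => by
      have hp' : p.HolderConjugate p.conjExponent := .conjExponent hp
      have hq' : q.HolderConjugate q.conjExponent := .conjExponent hq
      have h1 : Integrable (fun x => u x * ψ x) μ := hu.integrable_mul (hψ _ hp'.symm.one_le)
      have h2 : Integrable (fun x => v x * ψ x) μ := hv.integrable_mul (hψ _ hq'.symm.one_le)
      simp only [Pi.sub_apply, sub_mul]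
      rw [integral_sub h1 h2, h ψ hψ]
      simp
  filter_upwards [this] with x hx
  simpa [sub_eq_zero] using hx

end Truncation

/-! ### The pairing of `L^p` and `L^q`, and the dual of `L^1` -/

section Duality

variable {X : Type*} [MeasurableSpace X] {μ : Measure X} {w : X → ℝ}

theorem enorm_integral_mul_le {p q : ℝ≥0∞} [p.HolderConjugate q] {f ψ : X → ℂ}
    (hf : AEStronglyMeasurable f μ) (hψ : AEStronglyMeasurable ψ μ) :
    ‖∫ x, f x * ψ x ∂μ‖ₑ ≤ eLpNorm f p μ * eLpNorm ψ q μ := by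
  refine (enorm_integral_le_lintegral_enorm _).trans ?_
  have := eLpNorm_smul_le_mul_eLpNorm (r := 1) (p := p) (q := q) hψ hf
  rwa [eLpNorm_one_eq_lintegral_enorm] at this

theorem MeasureTheory.MemLp.integrable_mul_conj {p q : ℝ≥0∞} (hpq : p.HolderConjugate q)
    {f ψ : X → ℂ} (hf : MemLp f p μ) (hψ : MemLp ψ q μ) : Integrable (fun x => f x * ψ x) μ :=
  hf.integrable_mul hψ

theorem tendsto_toLp_weightTrunc (hw : Measurable w) (hw' : ∀ x, 0 < w x) {p : ℝ≥0∞}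
    [Fact (1 ≤ p)] (hp' : p ≠ ∞) (f : Lp ℂ p μ) (h : ∀ n, MemLp (weightTrunc w n f) p μ) :
    Tendsto (fun n => (h n).toLp _) atTop (𝓝 f) := by
  rw [Lp.tendsto_Lp_iff_tendsto_eLpNorm']
  refine (tendsto_eLpNorm_weightTrunc_sub hw hw' Fact.out hp' (Lp.memLp f)).congr fun n => ?_
  refine eLpNorm_congr_ae ?_
  filter_upwards [(h n).coeFn_toLp] with x hx
  simp [hx]

/-- Bounded functionals on `L^1` of a σ-finite measure are given by functions in `L^∞`. -/
theorem exists_Linfty_of_dual_L1 [SigmaFinite μ] (Φ : Lp ℂ 1 μ →L[ℂ] ℂ) :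
    ∃ u : Lp ℂ ∞ μ, ‖u‖ ≤ ‖Φ‖ ∧ ∀ ψ : Lp ℂ 1 μ, Φ ψ = ∫ x, u x * ψ x ∂μ := by
  obtain ⟨w, hw⟩ := exists_isLpWeight μ
  have hwm : Measurable fun x => (w x : ℂ) := Complex.measurable_ofReal.comp hw.measurable
  have hw2 : MemLp (fun x => (w x : ℂ)) 2 μ :=
    hw.memLp_of_le hwm.aestronglyMeasurable 1
      (fun x => by simp [abs_of_pos (hw.pos x)]) one_le_two
  -- Multiplication by `w` maps `L^2` into `L^1`, so `g ↦ Φ (w g)` is represented by some `v` in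
  -- `L^2`. The density of `Φ` is then `conj v / w`.
  let Λ : Lp ℂ 2 μ →L[ℂ] ℂ := Φ ∘L ((ContinuousLinearMap.mul ℂ ℂ).holderL μ 2 2 1 (hw2.toLp _))
  let v : Lp ℂ 2 μ := (InnerProductSpace.toDual ℂ (Lp ℂ 2 μ)).symm Λ
  have hv : ∀ (g : X → ℂ) (hg : MemLp g 2 μ) (hwg : MemLp (fun x => (w x : ℂ) * g x) 1 μ),
      ∫ x, star (v x) * g x ∂μ = Φ (hwg.toLp _) := by
    intro g hg hwg
    have h1 : inner ℂ v (hg.toLp g) = Λ (hg.toLp g) := InnerProductSpace.toDual_symm_apply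
    have h2 : (ContinuousLinearMap.mul ℂ ℂ).holderL μ 2 2 1 (hw2.toLp _) (hg.toLp g)
        = hwg.toLp _ := by
      refine Lp.ext ?_
      filter_upwards [(ContinuousLinearMap.mul ℂ ℂ).coeFn_holder (r := 1) (hw2.toLp _) (hg.toLp g),
        hw2.coeFn_toLp, hg.coeFn_toLp, hwg.coeFn_toLp] with x h1 h2 h3 h4
      rw [h4]
      refine h1.trans ?_
      simp [h2, h3]
    have h3 : Λ (hg.toLp g) = Φ (hwg.toLp _) := congrArg Φ h2
    rw [← h3, ← h1, L2.inner_def]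
    refine integral_congr_ae ?_
    filter_upwards [hg.coeFn_toLp] with x hx
    rw [hx, RCLike.inner_apply, mul_comm]
    rfl
  -- Testing against `ψ` gives at most `‖Φ‖ ∫ w |ψ|`, so `conj v / w` is bounded by `‖Φ‖`.
  have hbound : ∀ᵐ x ∂μ, ‖star (v x)‖ₑ ≤ ‖Φ‖ₑ * ‖w x‖ₑ := by
    refine ae_enorm_le_of_forall_integral_mul_le (Lp.memLp v).star.1
      (fun s _ hs => (Lp.memLp v).star.integrableOn_of_measure_lt_top one_le_two hs) fun ψ hψ => ?_
    have hwψ : MemLp (fun x => (w x : ℂ) * ψ x) 1 μ :=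
      memLp_one_iff_integrable.2 (hw2.integrable_mul_conj ENNReal.HolderConjugate.instTwoTwo
        (hψ 2 one_le_two))
    refine (congrArg _ (hv ψ (hψ 2 one_le_two) hwψ)).le.trans ?_
    refine (Φ.le_opENorm _).trans ?_
    rw [Lp.enorm_toLp, eLpNorm_one_eq_lintegral_enorm,
      ← lintegral_const_mul' _ _ (by simp)]
    refine lintegral_mono fun x => ?_
    rw [enorm_mul, mul_assoc]
    gcongr
    simp [enorm_eq_nnnorm]
  have hum : AEStronglyMeasurable (fun x => star (v x) * (w x : ℂ)⁻¹) μ :=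
    (Lp.aestronglyMeasurable v).star.mul (hwm.inv.aestronglyMeasurable)
  have hub : ∀ᵐ x ∂μ, ‖star (v x) * (w x : ℂ)⁻¹‖ ≤ ‖Φ‖ := by
    filter_upwards [hbound] with x hx
    have h0 := hw.pos x
    rw [← enorm_norm Φ, ← enorm_mul, enorm_le_iff_norm_le, norm_mul, norm_norm] at hx
    rw [norm_mul, norm_inv, Complex.norm_real, ← div_eq_mul_inv, div_le_iff₀ (norm_pos_iff.2 h0.ne')]
    simpa using hx
  have hu : MemLp (fun x => star (v x) * (w x : ℂ)⁻¹) ∞ μ := memLp_top_of_bound hum _ hub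
  refine ⟨hu.toLp _, ?_, fun ψ => ?_⟩
  · rw [Lp.norm_toLp, eLpNorm_exponent_top]
    exact ENNReal.toReal_le_of_le_ofReal (norm_nonneg Φ) (eLpNormEssSup_le_of_ae_bound hub)
  · have hψ := Lp.memLp ψ
    -- Truncating along `w ^ 2` instead of `w` keeps the quotient of the truncation by `w` below `n
    -- w`, hence in `L^2`, where `hv` applies.
    have hw2m : Measurable fun x => w x ^ 2 := hw.measurable.pow_const 2
    have hw2p : ∀ x, 0 < w x ^ 2 := fun x => pow_pos (hw.pos x) 2
    have hle : ∀ n x, ‖weightTrunc (fun x => w x ^ 2) n ψ x‖ ≤ n * w x ^ 2 :=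
      fun n x => norm_weightTrunc_le_weight hw2p n ψ x
    have hm : ∀ n, AEStronglyMeasurable (weightTrunc (fun x => w x ^ 2) n ψ) μ :=
      fun n => hψ.1.weightTrunc hw2m n
    have h1 : ∀ n, MemLp (weightTrunc (fun x => w x ^ 2) n ψ) 1 μ := fun n =>
      hψ.mono (hm n) (ae_of_all _ fun x => norm_weightTrunc_le _ n ψ x)
    have h2 := (Φ.continuous.tendsto ψ).comp
      (tendsto_toLp_weightTrunc hw2m hw2p ENNReal.one_ne_top ψ h1)
    have h3 := tendsto_integral_weightTrunc_mul hw2m hw2p hψ.1 hum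
      (hψ.integrable_mul_conj inferInstance hu)
    have h4 : ∫ x, hu.toLp _ x * ψ x ∂μ = ∫ x, ψ x * (star (v x) * (w x : ℂ)⁻¹) ∂μ := by
      refine integral_congr_ae ?_
      filter_upwards [hu.coeFn_toLp] with x hx
      rw [hx, mul_comm]
    rw [h4]
    refine tendsto_nhds_unique h2 (h3.congr fun n => ?_)
    have hg : MemLp (fun x => (w x : ℂ)⁻¹ * weightTrunc (fun x => w x ^ 2) n ψ x) 2 μ := by
      refine hw.memLp_of_le (hwm.inv.aestronglyMeasurable.mul (hm n)) n (fun x => ?_) one_le_two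
      have h0 := hw.pos x
      simp only [Pi.mul_apply, Pi.inv_apply]
      rw [norm_mul, norm_inv, Complex.norm_real, Real.norm_of_nonneg h0.le,
        inv_mul_le_iff₀ h0]
      exact (hle n x).trans_eq (by ring)
    have hwg : (fun x => (w x : ℂ) * ((w x : ℂ)⁻¹ * weightTrunc (fun x => w x ^ 2) n ψ x))
        = weightTrunc (fun x => w x ^ 2) n ψ := by
      funext x
      have h0 : (w x : ℂ) ≠ 0 := by exact_mod_cast (hw.pos x).ne'
      rw [mul_inv_cancel_left₀ h0]
    have h5 := hv _ hg (by rw [hwg]; exact h1 n)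
    simp only [hwg] at h5
    rw [Function.comp_apply, ← h5]
    refine integral_congr_ae (ae_of_all _ fun x => ?_)
    simp only
    ring

end Duality

/-! ### Extension of operators from `L^2` to `L^p` -/

section Extension

variable {X : Type*} [MeasurableSpace X] {μ : Measure X}

/-- `T` is bounded by `M` in the norms of `L^p` for all `p ∈ [1, ∞)`. -/
noncomputable def IsLpBounded (T : Lp ℂ 2 μ →L[ℂ] Lp ℂ 2 μ) (M : ℝ≥0) : Prop :=
  ∀ p : ℝ≥0∞, 1 ≤ p → p ≠ ∞ → ∀ f : Lp ℂ 2 μ, eLpNorm (T f) p μ ≤ M * eLpNorm f p μ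

/-- Truncations belong to `L^2 ∩ L^p` and converge in `L^p` for `p < ∞`, so `L^2 ∩ L^p` has dense
image and `T` extends from it by continuity with the same bound. -/
theorem IsLpBounded.exists_extension [SigmaFinite μ] {T : Lp ℂ 2 μ →L[ℂ] Lp ℂ 2 μ} {M : ℝ≥0}
    (hT : IsLpBounded T M) (p : ℝ≥0∞) [Fact (1 ≤ p)] (hp : p ≠ ∞) :
    ∃ S : Lp ℂ p μ →L[ℂ] Lp ℂ p μ,
      (∀ (f : Lp ℂ 2 μ) (g : Lp ℂ p μ), f =ᵐ[μ] g → T f =ᵐ[μ] S g) ∧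
      ∀ g, ‖S g‖ ≤ M * ‖g‖ := by
  have hp1 : 1 ≤ p := Fact.out
  have hTm : ∀ f : Lp ℂ 2 μ, MemLp f p μ → MemLp (T f) p μ := fun f hf =>
    ⟨Lp.aestronglyMeasurable _, (hT p hp1 hp f).trans_lt
      (ENNReal.mul_lt_top ENNReal.coe_lt_top hf.2)⟩
  let D : Submodule ℂ (Lp ℂ 2 μ) :=
    { carrier := {f | MemLp f p μ}
      add_mem' := fun {f g} hf hg => (hf.add hg).ae_eq (Lp.coeFn_add f g).symm
      zero_mem' := MemLp.zero.ae_eq (Lp.coeFn_zero ℂ 2 μ).symm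
      smul_mem' := fun c f hf => (hf.const_smul c).ae_eq (Lp.coeFn_smul c f).symm }
  let e : D →ₗ[ℂ] Lp ℂ p μ :=
    { toFun := fun f => MemLp.toLp (f : Lp ℂ 2 μ) f.2
      map_add' := fun f g => by
        rw [← MemLp.toLp_add]
        exact MemLp.toLp_congr _ _ (Lp.coeFn_add (f : Lp ℂ 2 μ) g)
      map_smul' := fun c f => by
        rw [RingHom.id_apply, ← MemLp.toLp_const_smul]
        exact MemLp.toLp_congr _ _ (Lp.coeFn_smul c (f : Lp ℂ 2 μ)) }
  let F : D →ₗ[ℂ] Lp ℂ p μ := e ∘ₗ (T.toLinearMap.restrict (p := D) (q := D) fun f hf => hTm f hf)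
  have hdense : DenseRange e := by
    obtain ⟨w, hw⟩ := exists_isLpWeight μ
    intro f
    have hf := Lp.aestronglyMeasurable f
    refine mem_closure_of_tendsto (tendsto_toLp_weightTrunc hw.measurable hw.pos hp f
      fun n => hw.memLp_weightTrunc hf n hp1) (Eventually.of_forall fun n => ?_)
    have h2 := hw.memLp_weightTrunc hf n one_le_two
    refine ⟨⟨h2.toLp _, (hw.memLp_weightTrunc hf n hp1).ae_eq h2.coeFn_toLp.symm⟩, ?_⟩
    exact MemLp.toLp_congr ((hw.memLp_weightTrunc hf n hp1).ae_eq h2.coeFn_toLp.symm) _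
      h2.coeFn_toLp
  have hnorm : ∀ f, ‖F f‖ ≤ M * ‖e f‖ := fun f => by
    change ‖MemLp.toLp (T f) (hTm f f.2)‖ ≤ M * ‖MemLp.toLp (f : Lp ℂ 2 μ) f.2‖
    rw [Lp.norm_toLp, Lp.norm_toLp, ← ENNReal.coe_toReal M, ← ENNReal.toReal_mul]
    exact ENNReal.toReal_mono (ENNReal.mul_ne_top ENNReal.coe_ne_top f.2.2.ne) (hT p hp1 hp f)
  refine ⟨F.extendOfNorm e, fun f g hfg => ?_,
    LinearMap.norm_extendOfNorm_apply_le hdense M hnorm⟩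
  have hf : MemLp f p μ := (Lp.memLp g).ae_eq hfg.symm
  have h1 : e ⟨f, hf⟩ = g := Lp.ext (hf.coeFn_toLp.trans hfg)
  rw [← h1, LinearMap.extendOfNorm_eq hdense ⟨M, hnorm⟩]
  exact (hTm f hf).coeFn_toLp.symm

end Extension

/-! ### Transposes, extension to `L^∞`, and pairings as limits over truncations -/

section Transpose

variable {X : Type*} [MeasurableSpace X] {μ : Measure X}

theorem MeasureTheory.Lp.star_add' {p : ℝ≥0∞} (f g : Lp ℂ p μ) : star (f + g) = star f + star g := by
  refine Lp.ext ?_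
  filter_upwards [Lp.coeFn_star (f + g), Lp.coeFn_add f g, Lp.coeFn_add (star f) (star g),
    Lp.coeFn_star f, Lp.coeFn_star g] with x h1 h2 h3 h4 h5
  rw [h1, h3, Pi.star_apply, h2, Pi.add_apply, Pi.add_apply, h4, h5, star_add, Pi.star_apply,
    Pi.star_apply]

theorem MeasureTheory.Lp.star_smul' {p : ℝ≥0∞} (c : ℂ) (f : Lp ℂ p μ) :
    star (c • f) = star c • star f := by
  refine Lp.ext ?_
  filter_upwards [Lp.coeFn_star (c • f), Lp.coeFn_smul c f, Lp.coeFn_smul (star c) (star f),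
    Lp.coeFn_star f] with x h1 h2 h3 h4
  rw [h1, h3, Pi.star_apply, h2, Pi.smul_apply, Pi.smul_apply, h4, star_smul, Pi.star_apply]

theorem MeasureTheory.Lp.eLpNorm_star {p : ℝ≥0∞} (r : ℝ≥0∞) (f : Lp ℂ p μ) :
    eLpNorm (star f : Lp ℂ p μ) r μ = eLpNorm f r μ := by
  refine eLpNorm_congr_norm_ae ?_
  filter_upwards [Lp.coeFn_star f] with x hx
  simp [hx]

/-- The operator `f ↦ conj (T (conj f))`. -/
noncomputable def conjOperator (T : Lp ℂ 2 μ →L[ℂ] Lp ℂ 2 μ) : Lp ℂ 2 μ →L[ℂ] Lp ℂ 2 μ :=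
  LinearMap.mkContinuous
    { toFun := fun f => star (T (star f))
      map_add' := fun f g => by rw [Lp.star_add', map_add, Lp.star_add']
      map_smul' := fun c f => by
        rw [Lp.star_smul', map_smul, Lp.star_smul', star_star, RingHom.id_apply] }
    ‖T‖ fun f => by
      have h : ∀ g : Lp ℂ 2 μ, ‖star g‖ = ‖g‖ := fun g => by
        rw [Lp.norm_def, Lp.norm_def, Lp.eLpNorm_star]
      change ‖star (T (star f))‖ ≤ _
      rw [h, ← h f]
      exact T.le_opNorm _

theorem conjOperator_apply (T : Lp ℂ 2 μ →L[ℂ] Lp ℂ 2 μ) (f : Lp ℂ 2 μ) :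
    conjOperator T f = star (T (star f)) := rfl

theorem IsLpBounded.conjOperator {T : Lp ℂ 2 μ →L[ℂ] Lp ℂ 2 μ} {M : ℝ≥0} (hT : IsLpBounded T M) :
    IsLpBounded (conjOperator T) M := fun p hp hp' f => by
  rw [conjOperator_apply, Lp.eLpNorm_star, ← Lp.eLpNorm_star p f]
  exact hT p hp hp' _

theorem inner_star_eq_integral (f g : Lp ℂ 2 μ) : inner ℂ (star f) g = ∫ x, g x * f x ∂μ := by
  rw [L2.inner_def]
  refine integral_congr_ae ?_
  filter_upwards [Lp.coeFn_star f] with x hx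
  simp [hx]

/-- The pairing `∫ f g` is bilinear while the inner product is sesquilinear; conjugating the adjoint
therefore gives the transpose. -/
theorem integral_mul_conjOperator_adjoint (T : Lp ℂ 2 μ →L[ℂ] Lp ℂ 2 μ) (f g : Lp ℂ 2 μ) :
    ∫ x, T f x * g x ∂μ = ∫ x, f x * conjOperator (ContinuousLinearMap.adjoint T) g x ∂μ := by
  rw [← inner_star_eq_integral, ← inner_star_eq_integral, conjOperator_apply, star_star,
    ContinuousLinearMap.adjoint_inner_left]

/-- The bilinear pairing of `L^p` and `L^q`. -/
noncomputable abbrev lpPair (μ : Measure X) (p q : ℝ≥0∞) [Fact (1 ≤ p)] [Fact (1 ≤ q)]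
    [p.HolderConjugate q] : Lp ℂ p μ →L[ℂ] Lp ℂ q μ →L[ℂ] ℂ :=
  (ContinuousLinearMap.mul ℂ ℂ).lpPairing μ p q

theorem lpPair_apply {p q : ℝ≥0∞} [Fact (1 ≤ p)] [Fact (1 ≤ q)] [p.HolderConjugate q]
    (f : Lp ℂ p μ) (g : Lp ℂ q μ) : lpPair μ p q f g = ∫ x, f x * g x ∂μ :=
  (ContinuousLinearMap.mul ℂ ℂ).lpPairing_eq_integral f g

theorem norm_lpPair_le {p q : ℝ≥0∞} [Fact (1 ≤ p)] [Fact (1 ≤ q)] [p.HolderConjugate q]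
    (f : Lp ℂ p μ) (g : Lp ℂ q μ) : ‖lpPair μ p q f g‖ ≤ ‖f‖ * ‖g‖ := by
  rw [lpPair_apply, Lp.norm_def, Lp.norm_def, ← ENNReal.toReal_mul, ← toReal_enorm]
  exact ENNReal.toReal_mono (ENNReal.mul_ne_top (Lp.eLpNorm_ne_top f) (Lp.eLpNorm_ne_top g))
    (enorm_integral_mul_le (Lp.aestronglyMeasurable f) (Lp.aestronglyMeasurable g))

theorem lpPair_injective [SigmaFinite μ] {p q : ℝ≥0∞} [hp : Fact (1 ≤ p)] [hq : Fact (1 ≤ q)]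
    [p.HolderConjugate q] : Function.Injective (lpPair μ p q) := fun f g h => by
  refine Lp.ext (ae_eq_of_forall_integral_mul_eq hp.1 hp.1 (Lp.memLp f) (Lp.memLp g)
    fun ψ hψ => ?_)
  have h1 := congrArg (fun Φ => Φ ((hψ q hq.1).toLp ψ)) h
  simp only [lpPair_apply] at h1
  have h2 : ∀ f : Lp ℂ p μ, ∫ x, f x * (hψ q hq.1).toLp ψ x ∂μ = ∫ x, f x * ψ x ∂μ := fun f => by
    refine integral_congr_ae ?_
    filter_upwards [(hψ q hq.1).coeFn_toLp] with x hx
    rw [hx]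
  rwa [h2, h2] at h1

/-- `S` is the dual of the `L^1`-extension `S₁` of the transpose of `T`. Weak-star continuity is
then built in, with `g' = S₁ g`, and `S` agrees with `T` on `L^2 ∩ L^∞` because transposition holds
in `L^2`. -/
theorem IsLpBounded.exists_isLpExtension_top [SigmaFinite μ] {T : Lp ℂ 2 μ →L[ℂ] Lp ℂ 2 μ}
    {M : ℝ≥0} (hT : IsLpBounded (ContinuousLinearMap.adjoint T) M) :
    ∃ S : Lp ℂ ∞ μ →L[ℂ] Lp ℂ ∞ μ, IsLpExtension T ∞ S ∧ ∀ g, ‖S g‖ ≤ M * ‖g‖ := by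
  obtain ⟨S₁, hS₁, hS₁M⟩ := hT.conjOperator.exists_extension 1 ENNReal.one_ne_top
  let Φ : Lp ℂ ∞ μ → Lp ℂ 1 μ →L[ℂ] ℂ := fun f => (lpPair μ ∞ 1 f) ∘L S₁
  have hΦ : ∀ f, ‖Φ f‖ ≤ M * ‖f‖ := fun f =>
    ContinuousLinearMap.opNorm_le_bound _ (by positivity) fun g => by
      refine (norm_lpPair_le f (S₁ g)).trans ?_
      rw [mul_right_comm, mul_comm]
      exact mul_le_mul_of_nonneg_right (hS₁M g) (norm_nonneg _)
  choose u hu hu' using fun f => exists_Linfty_of_dual_L1 (Φ f)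
  have hpair : ∀ f, lpPair μ ∞ 1 (u f) = Φ f := fun f => by
    ext ψ
    rw [lpPair_apply, hu']
  let S : Lp ℂ ∞ μ →L[ℂ] Lp ℂ ∞ μ := LinearMap.mkContinuous
    { toFun := u
      map_add' := fun f g => lpPair_injective (q := 1) (by
        rw [map_add, hpair, hpair, hpair]
        simp only [Φ, map_add, ContinuousLinearMap.add_comp])
      map_smul' := fun c f => lpPair_injective (q := 1) (by
        rw [map_smul, hpair, hpair]
        simp only [Φ, map_smul, ContinuousLinearMap.smul_comp, RingHom.id_apply]) }
    M fun f => (hu f).trans (hΦ f)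
  have hSg : ∀ (g : X → ℂ) (hg : MemLp g 1 μ) (f : Lp ℂ ∞ μ),
      ∫ x, S f x * g x ∂μ = ∫ x, f x * S₁ (hg.toLp g) x ∂μ := fun g hg f => by
    have h := hu' f (hg.toLp g)
    rw [← lpPair_apply]
    refine Eq.trans (integral_congr_ae ?_) h.symm
    filter_upwards [hg.coeFn_toLp] with x hx
    rw [hx]
    rfl
  refine ⟨S, ⟨fun f g hfg => ?_, fun _ g hg => ⟨S₁ (hg.toLp g), Lp.memLp _, hSg g hg⟩⟩,
    fun g => (hu g).trans (hΦ g)⟩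
  refine ae_eq_of_forall_integral_mul_eq one_le_two le_top (Lp.memLp _) (Lp.memLp _) fun ψ hψ => ?_
  rw [hSg ψ (hψ 1 le_rfl)]
  have h2 := hψ 2 one_le_two
  have h3 := hS₁ (h2.toLp ψ) ((hψ 1 le_rfl).toLp ψ) (h2.coeFn_toLp.trans
    (hψ 1 le_rfl).coeFn_toLp.symm)
  calc ∫ x, T f x * ψ x ∂μ = ∫ x, T f x * h2.toLp ψ x ∂μ := by
        refine integral_congr_ae ?_
        filter_upwards [h2.coeFn_toLp] with x hx
        rw [hx]
    _ = _ := by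
        rw [integral_mul_conjOperator_adjoint]
        refine integral_congr_ae ?_
        filter_upwards [h3, hfg] with x h3 hfg
        rw [h3, hfg]

theorem IsLpBounded.exists_isLpExtension [SigmaFinite μ] {T : Lp ℂ 2 μ →L[ℂ] Lp ℂ 2 μ}
    {M : ℝ≥0} (hT : IsLpBounded T M) (hT' : IsLpBounded (ContinuousLinearMap.adjoint T) M)
    (p : ℝ≥0∞) [Fact (1 ≤ p)] : ∃ S, IsLpExtension T p S := by
  rcases eq_or_ne p ∞ with rfl | hp
  · obtain ⟨S, hS, -⟩ := hT'.exists_isLpExtension_top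
    exact ⟨S, hS⟩
  · obtain ⟨S, hS, -⟩ := hT.exists_extension p hp
    exact ⟨S, hS, fun h => absurd h hp⟩

/-- This adds the exponent `∞`, which `IsLpBounded` leaves out; there the bound is read off from the
extension. -/
theorem IsLpBounded.eLpNorm_le [SigmaFinite μ] {T : Lp ℂ 2 μ →L[ℂ] Lp ℂ 2 μ}
    {M : ℝ≥0} (hT : IsLpBounded T M) (hT' : IsLpBounded (ContinuousLinearMap.adjoint T) M)
    {p : ℝ≥0∞} (hp : 1 ≤ p) {f : Lp ℂ 2 μ} (hf : MemLp f p μ) :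
    eLpNorm (T f) p μ ≤ M * eLpNorm f p μ := by
  rcases eq_or_ne p ∞ with rfl | hp'
  · obtain ⟨S, hS, hSM⟩ := hT'.exists_isLpExtension_top
    have h1 := hS.1 f (hf.toLp f) hf.coeFn_toLp.symm
    have h2 : ‖S (hf.toLp f)‖ₑ ≤ M * ‖hf.toLp f‖ₑ := by
      have := hSM (hf.toLp f)
      rw [enorm_eq_nnnorm, enorm_eq_nnnorm, ← ENNReal.coe_mul]
      exact_mod_cast this
    rwa [Lp.enorm_toLp, Lp.enorm_def, ← eLpNorm_congr_ae h1] at h2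
  · exact hT p hp hp' f

/-- The pairing of an extension with a function in `L^q` is the limit of the pairings of the
operator on `L^2`, applied to truncations. -/
theorem IsLpExtension.tendsto_integral {T : Lp ℂ 2 μ →L[ℂ] Lp ℂ 2 μ} {p q : ℝ≥0∞} [Fact (1 ≤ p)]
    (hpq : p.HolderConjugate q) {S : Lp ℂ p μ →L[ℂ] Lp ℂ p μ} (hS : IsLpExtension T p S)
    {w : X → ℝ} (hw : IsLpWeight μ w) (f : Lp ℂ p μ) (f' : ℕ → Lp ℂ 2 μ)
    (hf' : ∀ n, f' n =ᵐ[μ] weightTrunc w n f) {ψ : X → ℂ} (hψ : MemLp ψ q μ) :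
    Tendsto (fun n => ∫ x, T (f' n) x * ψ x ∂μ) atTop (𝓝 (∫ x, S f x * ψ x ∂μ)) := by
  have hp1 : 1 ≤ p := Fact.out
  have hfm := Lp.aestronglyMeasurable f
  have hm : ∀ n, MemLp (weightTrunc w n f) p μ := fun n => hw.memLp_weightTrunc hfm n hp1
  have h1 : ∀ n, ∫ x, T (f' n) x * ψ x ∂μ = ∫ x, S ((hm n).toLp _) x * ψ x ∂μ := fun n => by
    refine integral_congr_ae ?_
    filter_upwards [hS.1 (f' n) ((hm n).toLp _) ((hf' n).trans (hm n).coeFn_toLp.symm)] with x hx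
    rw [hx]
  simp_rw [h1]
  have : Fact (1 ≤ q) := ⟨hpq.symm.one_le⟩
  rcases eq_or_ne p ∞ with rfl | hp'
  -- Truncations need not converge in the norm of `L^∞`. Weak-star continuity moves `S` onto `ψ`,
  -- after which dominated convergence applies.
  · obtain rfl : q = 1 := by
      have := hpq.inv_add_inv_eq_inv
      simpa using this
    obtain ⟨g', hg', h⟩ := hS.2 rfl ψ hψ
    simp_rw [h]
    refine (tendsto_integral_weightTrunc_mul hw.measurable hw.pos hfm hg'.1
      ((Lp.memLp f).integrable_mul_conj hpq hg')).congr fun n => integral_congr_ae ?_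
    filter_upwards [(hm n).coeFn_toLp] with x hx
    rw [hx]
  · have h2 : ∀ g : Lp ℂ p μ, ∫ x, S g x * ψ x ∂μ = (lpPair μ p q).flip (hψ.toLp ψ) (S g) :=
      fun g => by
        rw [ContinuousLinearMap.flip_apply, lpPair_apply]
        refine integral_congr_ae ?_
        filter_upwards [hψ.coeFn_toLp] with x hx
        rw [hx]
    simp_rw [h2]
    exact ((((lpPair μ p q).flip (hψ.toLp ψ)).continuous.comp S.continuous).tendsto f).comp
      (tendsto_toLp_weightTrunc hw.measurable hw.pos hp' f hm)

end Transpose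

/-! ### Integrals of families of operators -/

section Family

variable {X : Type*} [MeasurableSpace X] {μ : Measure X}

/-- Convergence in `L^2` implies convergence in measure, along which the `L^p`-norm is lower
semicontinuous. With convexity, this lets `L^p`-bounds survive averages taken in `L^2`. -/
theorem isClosed_setOf_eLpNorm_le (p R : ℝ≥0∞) : IsClosed {g : Lp ℂ 2 μ | eLpNorm g p μ ≤ R} :=
  IsSeqClosed.isClosed fun _ _ hu hg => eLpNorm_le_of_tendstoInMeasure
    (Eventually.of_forall hu) (tendstoInMeasure_of_tendsto_Lp hg)
    fun _ => Lp.aestronglyMeasurable _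

theorem convex_setOf_eLpNorm_le {p : ℝ≥0∞} (hp : 1 ≤ p) (R : ℝ≥0∞) :
    Convex ℝ {g : Lp ℂ 2 μ | eLpNorm g p μ ≤ R} := by
  intro f hf g hg a b ha hb hab
  have h : (a • f + b • g : Lp ℂ 2 μ) =ᵐ[μ] a • (f : X → ℂ) + b • (g : X → ℂ) := by
    filter_upwards [Lp.coeFn_add (a • f) (b • g), Lp.coeFn_smul a f, Lp.coeFn_smul b g]
      with x h1 h2 h3
    rw [h1, Pi.add_apply, Pi.add_apply, h2, h3]
  have hfm := Lp.aestronglyMeasurable f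
  have hgm := Lp.aestronglyMeasurable g
  change eLpNorm (a • f + b • g : Lp ℂ 2 μ) p μ ≤ R
  rw [eLpNorm_congr_ae h]
  refine (eLpNorm_add_le (hfm.const_smul a) (hgm.const_smul b) hp).trans ?_
  rw [eLpNorm_const_smul, eLpNorm_const_smul, Real.enorm_of_nonneg ha, Real.enorm_of_nonneg hb]
  calc _ ≤ ENNReal.ofReal a * R + ENNReal.ofReal b * R := by gcongr <;> assumption
    _ = R := by rw [← add_mul, ← ENNReal.ofReal_add ha hb, hab, ENNReal.ofReal_one, one_mul]

/-- A measurable family of self-adjoint operators on `L^2` that contract all `L^p`-norms. -/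
structure IsContractionFamily (ν : Measure ℝ) (T : ℝ → Lp ℂ 2 μ →L[ℂ] Lp ℂ 2 μ) : Prop where
  aestronglyMeasurable : AEStronglyMeasurable T ν
  isLpBounded : ∀ᵐ t ∂ν, IsLpBounded (T t) 1
  isSelfAdjoint : ∀ᵐ t ∂ν, IsSelfAdjoint (T t)

theorem IsLpBounded.norm_le {T : Lp ℂ 2 μ →L[ℂ] Lp ℂ 2 μ} {M : ℝ≥0} (hT : IsLpBounded T M) :
    ‖T‖ ≤ M :=
  T.opNorm_le_bound M.2 fun f => by
    have h := hT 2 one_le_two (by simp) f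
    rw [Lp.norm_def, Lp.norm_def, ← ENNReal.coe_toReal M, ← ENNReal.toReal_mul]
    exact ENNReal.toReal_mono (ENNReal.mul_ne_top ENNReal.coe_ne_top (Lp.eLpNorm_ne_top f)) h

variable {ν : Measure ℝ} {T : ℝ → Lp ℂ 2 μ →L[ℂ] Lp ℂ 2 μ} {k : ℝ → ℂ}

theorem IsContractionFamily.integrable_smul (hT : IsContractionFamily ν T) (hk : Integrable k ν) :
    Integrable (fun t => k t • T t) ν := by
  refine hk.norm.mono' (hk.1.smul hT.aestronglyMeasurable) ?_
  filter_upwards [hT.isLpBounded] with t ht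
  rw [norm_smul]
  exact mul_le_of_le_one_right (norm_nonneg _) (by simpa using ht.norm_le)

theorem IsContractionFamily.integral_apply (hT : IsContractionFamily ν T) (hk : Integrable k ν)
    (f : Lp ℂ 2 μ) : (∫ t, k t • T t ∂ν) f = ∫ t, k t • T t f ∂ν :=
  ContinuousLinearMap.integral_apply (hT.integrable_smul hk) f

theorem IsContractionFamily.integrable_smul_apply (hT : IsContractionFamily ν T)
    (hk : Integrable k ν) (f : Lp ℂ 2 μ) : Integrable (fun t => k t • T t f) ν :=
  (ContinuousLinearMap.apply ℂ (Lp ℂ 2 μ) f).integrable_comp (hT.integrable_smul hk)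

/-- The adjoint is an integral of the same kind, so the bound on the integral also holds for its
adjoint, as extension to `L^∞` requires. -/
theorem IsContractionFamily.adjoint_integral (hT : IsContractionFamily ν T)
    (hk : Integrable k ν) :
    ContinuousLinearMap.adjoint (∫ t, k t • T t ∂ν) = ∫ t, star (k t) • T t ∂ν := by
  have hk' : Integrable (fun t => star (k t)) ν := memLp_one_iff_integrable.1 (memLp_one_iff_integrable.2 hk).star
  refine ((ContinuousLinearMap.eq_adjoint_iff _ _).2 fun f g => ?_).symm
  rw [hT.integral_apply hk, hT.integral_apply hk',
    ← integral_inner (hT.integrable_smul_apply hk g), ← inner_conj_symm,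
    ← integral_inner (hT.integrable_smul_apply hk' f), ← integral_conj]
  refine integral_congr_ae ?_
  filter_upwards [hT.isSelfAdjoint] with t ht
  rw [inner_conj_symm, inner_smul_left, inner_smul_right]
  have h := ContinuousLinearMap.adjoint_inner_left (T t) g f
  rw [ContinuousLinearMap.isSelfAdjoint_iff'.1 ht] at h
  rw [h]
  simp

/-- With respect to `|k| ν`, the integral is the total mass times the average of the vectors `(k /
|k|) T f`. These lie in the closed convex set of functions with `L^p`-norm at most that of `f`,
hence so does their average. -/
theorem IsContractionFamily.isLpBounded_integral (hT : IsContractionFamily ν T)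
    (hk : Integrable k ν) : IsLpBounded (∫ t, k t • T t ∂ν) ((∫ t, ‖k t‖ ∂ν).toNNReal + 1) := by
  intro p hp hp' f
  -- The `+ 1` keeps the constant nonzero, so that its product with `∞` is `∞` even when `k`
  -- vanishes.
  rcases eq_or_ne (eLpNorm f p μ) ∞ with htop | htop
  · rw [htop, ENNReal.mul_top (by simp)]
    exact le_top
  have hkm : AEMeasurable (fun t => ‖k t‖₊) ν := hk.1.nnnorm.aemeasurable
  let ν' : Measure ℝ := ν.withDensity fun t => ‖k t‖₊
  let G : ℝ → Lp ℂ 2 μ := fun t => (k t * (‖k t‖ : ℂ)⁻¹) • T t f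
  have hG : ∀ t, ‖k t‖₊ • G t = k t • T t f := fun t => by
    simp only [G]
    rcases eq_or_ne (k t) 0 with h0 | h0
    · simp [h0]
    · have h1 : (‖k t‖ : ℂ) ≠ 0 := by simpa using h0
      rw [NNReal.smul_def, coe_nnnorm, ← smul_assoc, Complex.real_smul, mul_left_comm,
        mul_inv_cancel₀ h1, mul_one]
  have hfin : ν' univ = ENNReal.ofReal (∫ t, ‖k t‖ ∂ν) := by
    rw [ofReal_integral_norm_eq_lintegral_enorm hk, withDensity_apply _ MeasurableSet.univ,
      Measure.restrict_univ]
    rfl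
  have : IsFiniteMeasure ν' := ⟨by rw [hfin]; exact ENNReal.ofReal_lt_top⟩
  have hGi : Integrable G ν' := by
    rw [integrable_withDensity_iff_integrable_smul₀ hkm]
    simp_rw [hG]
    exact hT.integrable_smul_apply hk f
  have hint : (∫ t, k t • T t ∂ν) f = ∫ t, G t ∂ν' := by
    rw [hT.integral_apply hk, integral_withDensity_eq_integral_smul₀ hkm]
    exact integral_congr_ae (ae_of_all _ fun t => (hG t).symm)
  rw [hint]
  rcases eq_or_ne ν' 0 with h0 | h0
  · rw [h0, integral_zero_measure, eLpNorm_congr_ae (Lp.coeFn_zero ℂ 2 μ)]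
    simp
  have : NeZero ν' := ⟨h0⟩
  have hmem : ∀ᵐ t ∂ν', G t ∈ {g : Lp ℂ 2 μ | eLpNorm g p μ ≤ eLpNorm f p μ} := by
    refine (withDensity_absolutelyContinuous ν _).ae_le ?_
    filter_upwards [hT.isLpBounded] with t ht
    rw [eLpNorm_congr_ae (Lp.coeFn_smul _ (T t f)), eLpNorm_const_smul]
    refine (mul_le_of_le_one_left' ?_).trans ((ht p hp hp' f).trans_eq (by simp))
    rw [← ofReal_norm]
    refine ENNReal.ofReal_le_one.2 ?_
    simp only [norm_mul, norm_inv, Complex.norm_real, norm_norm]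
    exact mul_inv_le_one
  have havg : eLpNorm (⨍ t, G t ∂ν' : Lp ℂ 2 μ) p μ ≤ eLpNorm f p μ :=
    (convex_setOf_eLpNorm_le hp _).average_mem (isClosed_setOf_eLpNorm_le p _) hmem hGi
  rw [← measure_smul_average ν' G, eLpNorm_congr_ae (Lp.coeFn_smul _ _), eLpNorm_const_smul,
    Real.enorm_of_nonneg measureReal_nonneg, ofReal_measureReal, hfin]
  gcongr
  rw [ENNReal.ofReal]
  exact_mod_cast le_self_add

theorem integral_smul_lp_mul {p : ℝ≥0∞} (c : ℂ) (f : Lp ℂ p μ) (ψ : X → ℂ) :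
    ∫ x, (c • f : Lp ℂ p μ) x * ψ x ∂μ = c * ∫ x, f x * ψ x ∂μ := by
  rw [← integral_const_mul]
  refine integral_congr_ae ?_
  filter_upwards [Lp.coeFn_smul c f] with x hx
  rw [hx, Pi.smul_apply, smul_eq_mul, mul_assoc]

/-- A limit procedure for identities between weak integrals. -/
theorem integral_limit_of_dominated (hk : Integrable k ν) {F : ℕ → ℝ → ℂ} {G : ℝ → ℂ} {B : ℝ}
    {I : ℕ → ℂ} {J : ℂ} (hF : ∀ n, AEStronglyMeasurable (F n) ν)
    (hB : ∀ᵐ t ∂ν, ∀ n, ‖F n t‖ ≤ B) (hlim : ∀ᵐ t ∂ν, Tendsto (fun n => F n t) atTop (𝓝 (G t)))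
    (hI : ∀ n, I n = ∫ t, k t * F n t ∂ν) (hJ : Tendsto I atTop (𝓝 J)) :
    AEStronglyMeasurable G ν ∧ (∀ᵐ t ∂ν, ‖G t‖ ≤ B) ∧ J = ∫ t, k t * G t ∂ν := by
  refine ⟨aestronglyMeasurable_of_tendsto_ae atTop hF hlim, ?_, ?_⟩
  · filter_upwards [hB, hlim] with t h1 h2
    exact le_of_tendsto' h2.norm h1
  · refine tendsto_nhds_unique hJ ?_
    rw [funext hI]
    refine tendsto_integral_of_dominated_convergence (fun t => ‖k t‖ * B)
      (fun n => hk.1.mul (hF n)) (hk.norm.mul_const B) (fun n => ?_) ?_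
    · filter_upwards [hB] with t ht
      rw [norm_mul]
      exact mul_le_mul_of_nonneg_left (ht n) (norm_nonneg _)
    · filter_upwards [hlim] with t ht
      exact ht.const_mul _

theorem norm_integral_mul_le_of_eLpNorm_le {p q : ℝ≥0∞} (hpq : p.HolderConjugate q)
    {f ψ : X → ℂ} {a b : ℝ≥0∞} (hf : AEStronglyMeasurable f μ) (hψ : AEStronglyMeasurable ψ μ)
    (ha : a ≠ ∞) (hb : b ≠ ∞) (hfa : eLpNorm f p μ ≤ a) (hψb : eLpNorm ψ q μ ≤ b) :
    ‖∫ x, f x * ψ x ∂μ‖ ≤ (a * b).toReal := by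
  rw [← toReal_enorm]
  exact ENNReal.toReal_mono (ENNReal.mul_ne_top ha hb)
    ((enorm_integral_mul_le (p := p) (q := q) hf hψ).trans (mul_le_mul' hfa hψb))

theorem IsContractionFamily.eLpNorm_le [SigmaFinite μ] (hT : IsContractionFamily ν T) :
    ∀ᵐ t ∂ν, ∀ p : ℝ≥0∞, 1 ≤ p → ∀ f : Lp ℂ 2 μ, MemLp f p μ →
      eLpNorm (T t f) p μ ≤ eLpNorm f p μ := by
  filter_upwards [hT.isLpBounded, hT.isSelfAdjoint] with t h1 h2 p hp f hf
  have h3 := h1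
  rw [← ContinuousLinearMap.isSelfAdjoint_iff'.1 h2] at h3
  simpa using h1.eLpNorm_le h3 hp hf

/-- For `ψ` in `L^2` the pairing is an inner product and commutes with the Bochner integral. A
general `ψ` is the limit of its truncations. -/
theorem IsContractionFamily.integral_apply_mul [SigmaFinite μ] (hT : IsContractionFamily ν T)
    (hk : Integrable k ν) {p q : ℝ≥0∞} (hpq : p.HolderConjugate q) {f : Lp ℂ 2 μ}
    (hf : MemLp f p μ) (hHf : MemLp ((∫ t, k t • T t ∂ν) f : Lp ℂ 2 μ) p μ)
    {ψ : X → ℂ} (hψ : MemLp ψ q μ) :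
    AEStronglyMeasurable (fun t => ∫ x, T t f x * ψ x ∂μ) ν ∧
      (∀ᵐ t ∂ν, ‖∫ x, T t f x * ψ x ∂μ‖ ≤ (eLpNorm f p μ * eLpNorm ψ q μ).toReal) ∧
      ∫ x, (∫ t, k t • T t ∂ν) f x * ψ x ∂μ = ∫ t, k t * ∫ x, T t f x * ψ x ∂μ ∂ν := by
  obtain ⟨w, hw⟩ := exists_isLpWeight μ
  have h2 : ∀ n, MemLp (weightTrunc w n ψ) 2 μ := fun n =>
    hw.memLp_weightTrunc hψ.1 n one_le_two
  have hpair : ∀ n (g : Lp ℂ 2 μ), ∫ x, g x * weightTrunc w n ψ x ∂μ =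
      inner ℂ (star ((h2 n).toLp _)) g := fun n g => by
    rw [inner_star_eq_integral]
    refine integral_congr_ae ?_
    filter_upwards [(h2 n).coeFn_toLp] with x hx
    rw [hx]
  have hlim : ∀ g : Lp ℂ 2 μ, MemLp g p μ →
      Tendsto (fun n => ∫ x, g x * weightTrunc w n ψ x ∂μ) atTop (𝓝 (∫ x, g x * ψ x ∂μ)) :=
    fun g hg => by
      simp_rw [mul_comm (g _)]
      exact tendsto_integral_weightTrunc_mul hw.measurable hw.pos hψ.1 hg.1
        (hψ.integrable_mul_conj hpq.symm hg)
  refine integral_limit_of_dominated hk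
    (F := fun n t => ∫ x, T t f x * weightTrunc w n ψ x ∂μ)
    (I := fun n => ∫ x, (∫ t, k t • T t ∂ν) f x * weightTrunc w n ψ x ∂μ)
    (fun n => ?_) ?_ ?_ (fun n => ?_) (hlim _ hHf)
  · simp_rw [hpair]
    exact aestronglyMeasurable_const.inner
      ((ContinuousLinearMap.apply ℂ (Lp ℂ 2 μ) f).continuous.comp_aestronglyMeasurable
        hT.aestronglyMeasurable)
  · filter_upwards [hT.eLpNorm_le] with t ht n
    exact norm_integral_mul_le_of_eLpNorm_le hpq (Lp.aestronglyMeasurable _)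
      (hψ.1.weightTrunc hw.measurable n) hf.2.ne hψ.2.ne (ht p hpq.one_le f hf)
      (eLpNorm_mono (norm_weightTrunc_le w n ψ))
  · filter_upwards [hT.eLpNorm_le] with t ht
    exact hlim _ ⟨Lp.aestronglyMeasurable _, (ht p hpq.one_le f hf).trans_lt hf.2⟩
  · simp only [hpair]
    rw [hT.integral_apply hk, ← integral_inner (hT.integrable_smul_apply hk f)]
    simp_rw [inner_smul_right]

/-- The function `u` is the extension to `L^p` of `∫ k T dν`, applied to `f`. The identity holds for
truncations of `f` and passes to the limit by dominated convergence in `t`. -/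
theorem IsContractionFamily.exists_integral_mul [SigmaFinite μ] (hT : IsContractionFamily ν T)
    (hk : Integrable k ν) {p : ℝ≥0∞} [Fact (1 ≤ p)] {S : ℝ → Lp ℂ p μ →L[ℂ] Lp ℂ p μ}
    (hS : ∀ᵐ t ∂ν, IsLpExtension (T t) p (S t)) (f : Lp ℂ p μ) :
    ∃ u : Lp ℂ p μ, ∀ (q : ℝ≥0∞) (_ : p.HolderConjugate q) (ψ : X → ℂ), MemLp ψ q μ →
      AEStronglyMeasurable (fun t => ∫ x, S t f x * ψ x ∂μ) ν ∧
      (∀ᵐ t ∂ν, ‖∫ x, S t f x * ψ x ∂μ‖ ≤ (eLpNorm f p μ * eLpNorm ψ q μ).toReal) ∧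
      ∫ x, u x * ψ x ∂μ = ∫ t, k t * ∫ x, S t f x * ψ x ∂μ ∂ν := by
  have hH := hT.isLpBounded_integral hk
  have hH' : IsLpBounded (ContinuousLinearMap.adjoint (∫ t, k t • T t ∂ν))
      ((∫ t, ‖k t‖ ∂ν).toNNReal + 1) := by
    have hk' : Integrable (fun t => star (k t)) ν := memLp_one_iff_integrable.1 (memLp_one_iff_integrable.2 hk).star
    have h := hT.isLpBounded_integral hk'
    simp only [norm_star] at h
    rwa [hT.adjoint_integral hk]
  obtain ⟨SH, hSH⟩ := hH.exists_isLpExtension hH' p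
  obtain ⟨w, hw⟩ := exists_isLpWeight μ
  refine ⟨SH f, fun q hpq ψ hψ => ?_⟩
  have hfm := Lp.aestronglyMeasurable f
  have h2 : ∀ n, MemLp (weightTrunc w n f) 2 μ := fun n => hw.memLp_weightTrunc hfm n one_le_two
  let f' : ℕ → Lp ℂ 2 μ := fun n => (h2 n).toLp _
  have hf' : ∀ n, f' n =ᵐ[μ] weightTrunc w n f := fun n => (h2 n).coeFn_toLp
  have hf'p : ∀ n, MemLp (f' n) p μ := fun n =>
    (hw.memLp_weightTrunc hfm n Fact.out).ae_eq (hf' n).symm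
  have hle : ∀ n, eLpNorm (f' n) p μ ≤ eLpNorm f p μ := fun n => by
    rw [eLpNorm_congr_ae (hf' n)]
    exact eLpNorm_mono (norm_weightTrunc_le w n f)
  have hHf' : ∀ n, MemLp ((∫ t, k t • T t ∂ν) (f' n) : Lp ℂ 2 μ) p μ := fun n =>
    ⟨Lp.aestronglyMeasurable _, (hH.eLpNorm_le hH' Fact.out (hf'p n)).trans_lt
      (ENNReal.mul_lt_top ENNReal.coe_lt_top (hf'p n).2)⟩
  have key := fun n => hT.integral_apply_mul hk hpq (hf'p n) (hHf' n) hψ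
  refine integral_limit_of_dominated hk (fun n => (key n).1) ?_ ?_ (fun n => (key n).2.2)
    (hSH.tendsto_integral hpq hw f f' hf' hψ)
  · filter_upwards [ae_all_iff.2 fun n => (key n).2.1] with t ht n
    refine (ht n).trans (ENNReal.toReal_mono
      (ENNReal.mul_ne_top (Lp.eLpNorm_ne_top f) hψ.2.ne) ?_)
    gcongr
    exact hle n
  · filter_upwards [hS] with t ht
    exact ht.tendsto_integral hpq hw f f' hf' hψ

theorem IsContractionFamily.exists_hasWeakIntegral [SigmaFinite μ]
    (hT : IsContractionFamily ν T) (hk : Integrable k ν) {p : ℝ≥0∞} [Fact (1 ≤ p)]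
    {S : ℝ → Lp ℂ p μ →L[ℂ] Lp ℂ p μ} (hS : ∀ᵐ t ∂ν, IsLpExtension (T t) p (S t))
    (f : Lp ℂ p μ) : ∃ u, HasWeakIntegral ν (fun t => k t • S t f) u := by
  obtain ⟨u, hu⟩ := hT.exists_integral_mul hk hS f
  refine ⟨u, fun q hpq ψ hψ => ?_⟩
  obtain ⟨h1, h2, h3⟩ := hu q hpq ψ hψ
  simp only [integral_smul_lp_mul]
  refine ⟨?_, h3⟩
  exact hk.mul_bdd h1 h2

end Family

/-! ### The semigroup generated by a positive self-adjoint operator -/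

theorem exp_neg_mul_inv_sub_one_le {t r : ℝ} (ht : 0 < t) :
    ‖(if 0 < r then Real.exp (-(t * (1 / r - 1))) else 0)‖ ≤ Real.exp t * (|r| / t) := by
  split_ifs with hr
  · rw [Real.norm_of_nonneg (Real.exp_pos _).le, abs_of_pos hr]
    have h1 : -(t * (1 / r - 1)) = t + -(t / r) := by ring
    have h2 : Real.exp (-(t / r)) ≤ r / t := by
      -- This is `e^{-y} ≤ 1 / y` with `y = t / r`; the resulting bound gives joint continuity at `r
      -- = 0`.
      rw [Real.exp_neg, ← inv_div t r]
      have hpos : 0 < t / r := div_pos ht hr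
      exact inv_anti₀ hpos ((le_add_of_nonneg_right zero_le_one).trans (Real.add_one_le_exp _))
    rw [h1, Real.exp_add]
    exact mul_le_mul_of_nonneg_left h2 (Real.exp_pos _).le
  · rw [norm_zero]
    positivity

theorem continuousOn_exp_neg_mul_inv_sub_one :
    ContinuousOn (Function.uncurry fun t r : ℝ =>
      if 0 < r then Real.exp (-(t * (1 / r - 1))) else 0) (Ioi 0 ×ˢ univ) := by
  rintro ⟨t, r⟩ ⟨ht, -⟩
  have ht : 0 < t := ht
  refine ContinuousAt.continuousWithinAt ?_
  rcases lt_trichotomy r 0 with hr | rfl | hr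
  · refine (continuousAt_const (y := (0 : ℝ))).congr ?_
    filter_upwards [continuousAt_snd.eventually (gt_mem_nhds hr)] with x hx
    simp [Function.uncurry, not_lt.2 (le_of_lt hx)]
  · have h0 : (Function.uncurry fun t r : ℝ =>
        if 0 < r then Real.exp (-(t * (1 / r - 1))) else 0) (t, 0) = 0 := by
      simp [Function.uncurry]
    rw [ContinuousAt, h0]
    refine squeeze_zero_norm' (a := fun x : ℝ × ℝ => Real.exp x.1 * (|x.2| / x.1)) ?_ ?_
    · filter_upwards [continuousAt_fst.eventually (lt_mem_nhds ht)] with x hx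
      exact exp_neg_mul_inv_sub_one_le hx
    · have : ContinuousAt (fun x : ℝ × ℝ => Real.exp x.1 * (|x.2| / x.1)) (t, 0) :=
        (Real.continuous_exp.comp continuous_fst).continuousAt.mul
          ((continuous_abs.comp continuous_snd).continuousAt.div continuousAt_fst ht.ne')
      simpa [ContinuousAt] using this
  · have : ContinuousAt (fun x : ℝ × ℝ => Real.exp (-(x.1 * (1 / x.2 - 1)))) (t, r) := by
      refine Real.continuous_exp.continuousAt.comp (ContinuousAt.neg (continuousAt_fst.mul ?_))
      exact (continuousAt_const.div continuousAt_snd hr.ne').sub continuousAt_const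
    refine this.congr ?_
    filter_upwards [continuousAt_snd.eventually (lt_mem_nhds hr)] with x hx
    simp only [Function.uncurry]
    rw [if_pos hx]

/-- Joint continuity in `(t, r)` and compactness of the spectrum give convergence uniform in `r`,
hence continuity of `t ↦ e^{-tL}` in operator norm. -/
theorem continuousOn_expNeg {E : Type*} [NormedAddCommGroup E] [InnerProductSpace ℂ E]
    [CompleteSpace E] (L : E →ₗ.[ℂ] E) (hL : IsPosSelfAdjoint L) :
    ContinuousOn (expNeg L hL) (Ioi 0) := by
  intro t ht
  have hc := continuousOn_exp_neg_mul_inv_sub_one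
  refine continuousWithinAt_cfc_fun ?_ ?_
  · intro u hu
    obtain ⟨v, hv, h⟩ := (spectrum.isCompact (𝕜 := ℝ) (posResolvent L hL)).mem_uniformity_of_prod
      (hc.mono (prod_mono_right (subset_univ _))) ht (symm_le_uniformity hu)
    filter_upwards [hv] with s hs x hx
    exact h s hs x hx
  · filter_upwards [self_mem_nhdsWithin] with s hs
    exact hc.comp (f := fun r : ℝ => (s, r)) (by fun_prop) fun r _ => ⟨hs, mem_univ r⟩

section Semigroup

variable {X : Type*} [MeasurableSpace X] {μ : Measure X}

theorem hasWeakIntegral_weakIntegral {p : ℝ≥0∞} {ν : Measure ℝ} {G : ℝ → Lp ℂ p μ}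
    (h : ∃ u, HasWeakIntegral ν G u) : HasWeakIntegral ν G (weakIntegral ν G) := by
  unfold weakIntegral
  rw [dif_pos h]
  exact h.choose_spec

variable (L : Lp ℂ 2 μ →ₗ.[ℂ] Lp ℂ 2 μ) (hL : IsPosSelfAdjoint L)

theorem isSelfAdjoint_expNeg (t : ℝ) : IsSelfAdjoint (expNeg L hL t) :=
  cfc_predicate _ _

variable {L hL}

theorem IsLpContractive.isLpBounded (h : IsLpContractive L hL) {t : ℝ} (ht : 0 < t) :
    IsLpBounded (expNeg L hL t) 1 := fun p hp hp' f => by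
  simpa using h t ht p hp hp' f

theorem IsLpContractive.isContractionFamily (h : IsLpContractive L hL) {A : Set ℝ}
    (hA : MeasurableSet A) (hA' : A ⊆ Ioi 0) :
    IsContractionFamily (volume.restrict A) (expNeg L hL) where
  aestronglyMeasurable := ((continuousOn_expNeg L hL).mono hA').aestronglyMeasurable hA
  isLpBounded := ae_restrict_of_forall_mem hA fun _ ht => h.isLpBounded (hA' ht)
  isSelfAdjoint := ae_of_all _ fun t => isSelfAdjoint_expNeg L hL t

variable [SigmaFinite μ] {p : ℝ≥0∞} [Fact (1 ≤ p)]

theorem IsLpContractive.isLpExtension_heatLp (h : IsLpContractive L hL) {t : ℝ} (ht : 0 < t) :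
    IsLpExtension (expNeg L hL t) p (heatLp L hL p t) := by
  have h1 := h.isLpBounded ht
  have h2 : ∃ S, IsLpExtension (expNeg L hL t) p S := h1.exists_isLpExtension (by
    rwa [ContinuousLinearMap.isSelfAdjoint_iff'.1 (isSelfAdjoint_expNeg L hL t)]) p
  unfold heatLp lpExtension
  rw [dif_pos h2]
  exact h2.choose_spec

theorem IsLpContractive.hasWeakIntegral_laplaceOp (hcontr : IsLpContractive L hL) {h : ℝ → ℂ}
    (hh : IntegrableOn h (Ioi 0)) (f : Lp ℂ p μ) :
    HasWeakIntegral (volume.restrict (Ioi 0)) (fun t => h t • heatLp L hL p t f)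
      (laplaceOp L hL h f) :=
  hasWeakIntegral_weakIntegral <|
    (hcontr.isContractionFamily measurableSet_Ioi Subset.rfl).exists_hasWeakIntegral hh
      (ae_restrict_of_forall_mem measurableSet_Ioi fun _ ht => hcontr.isLpExtension_heatLp ht) f

theorem IsLpContractive.hasWeakIntegral_semigroupAverage (hcontr : IsLpContractive L hL)
    {s : ℝ} (hs : 0 < s) (f : Lp ℂ p μ) :
    HasWeakIntegral (volume.restrict (Ioc 0 s)) (fun t => heatLp L hL p t f)
      ((s : ℂ) • semigroupAverage L hL s f) := by
  have h0 : (s : ℂ) ≠ 0 := by exact_mod_cast hs.ne'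
  have h1 : (s : ℂ) • semigroupAverage L hL s f =
      weakIntegral (volume.restrict (Ioc 0 s)) fun t => heatLp L hL p t f := by
    unfold semigroupAverage
    rw [smul_smul]
    push_cast
    rw [mul_one_div_cancel h0, one_smul]
  rw [h1]
  refine hasWeakIntegral_weakIntegral ?_
  have h2 := (hcontr.isContractionFamily (measurableSet_Ioc (a := 0) (b := s))
    Ioc_subset_Ioi_self).exists_hasWeakIntegral (k := fun _ => 1) (p := p)
    (integrable_const 1)
    (ae_restrict_of_forall_mem measurableSet_Ioc fun t ht =>
      hcontr.isLpExtension_heatLp (Ioc_subset_Ioi_self ht)) f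
  simpa only [one_smul] using h2

theorem IsLpContractive.integral_heatLp_mul (hcontr : IsLpContractive L hL) (f : Lp ℂ p μ)
    {q : ℝ≥0∞} (hpq : p.HolderConjugate q) {ψ : X → ℂ} (hψ : MemLp ψ q μ) :
    AEStronglyMeasurable (fun t => ∫ x, heatLp L hL p t f x * ψ x ∂μ) (volume.restrict (Ioi 0)) ∧
      ∃ B : ℝ, ∀ᵐ t ∂volume.restrict (Ioi (0 : ℝ)), ‖∫ x, heatLp L hL p t f x * ψ x ∂μ‖ ≤ B := by
  -- Measurability and the bound do not involve the density `k`, so `k = 0` will do.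
  obtain ⟨u, hu⟩ := (hcontr.isContractionFamily measurableSet_Ioi
    Subset.rfl).exists_integral_mul (k := 0) (integrable_zero _ _ _)
    (ae_restrict_of_forall_mem measurableSet_Ioi fun _ ht => hcontr.isLpExtension_heatLp ht) f
  obtain ⟨h1, h2, -⟩ := hu q hpq ψ hψ
  exact ⟨h1, _, h2⟩

end Semigroup

/-! ### The class of functions `h` -/

section LaplaceClass

variable {C : ℝ≥0} {h : ℝ → ℂ}

theorem LaplaceClass.hasDerivAt (hh : LaplaceClass C h) {t : ℝ} (ht : 0 < t) :
    HasDerivAt h (derivWithin h (Ici 0) t) t :=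
  ((hh.contDiffOn.differentiableOn one_ne_zero t ht.le).hasDerivWithinAt).hasDerivAt
    (Ici_mem_nhds ht)

theorem LaplaceClass.aestronglyMeasurable_derivWithin (hh : LaplaceClass C h) :
    AEStronglyMeasurable (derivWithin h (Ici 0)) (volume.restrict (Ioi 0)) :=
  ((hh.contDiffOn.continuousOn_derivWithin (uniqueDiffOn_Ici 0) le_rfl).mono
    Ioi_subset_Ici_self).aestronglyMeasurable measurableSet_Ioi

theorem LaplaceClass.integrableOn_mul_derivWithin (hh : LaplaceClass C h) :
    IntegrableOn (fun t : ℝ => (t : ℂ) * derivWithin h (Ici 0) t) (Ioi 0) :=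
  ⟨Complex.continuous_ofReal.aestronglyMeasurable.mul hh.aestronglyMeasurable_derivWithin,
    hh.integral_le.trans_lt ENNReal.coe_lt_top⟩

theorem LaplaceClass.integrableOn_derivWithin (hh : LaplaceClass C h) {a : ℝ} (ha : 0 < a) :
    IntegrableOn (derivWithin h (Ici 0)) (Ioi a) := by
  have hsub : Ioi a ⊆ Ioi 0 := Ioi_subset_Ioi ha.le
  refine ((hh.integrableOn_mul_derivWithin.mono_set hsub).norm.const_mul a⁻¹).mono'
    (hh.aestronglyMeasurable_derivWithin.mono_set hsub) ?_
  refine ae_restrict_of_forall_mem measurableSet_Ioi fun t ht => ?_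
  have ht' : a < t := ht
  rw [norm_mul, Complex.norm_real, Real.norm_of_nonneg (ha.trans ht').le, ← mul_assoc]
  refine le_mul_of_one_le_left (norm_nonneg _) ?_
  rw [← div_eq_inv_mul, one_le_div ha]
  exact ht'.le

theorem LaplaceClass.tendsto_atTop_zero (hh : LaplaceClass C h) : Tendsto h atTop (𝓝 0) := by
  refine squeeze_zero_norm' ?_ hh.tendsto_atTop
  filter_upwards [eventually_ge_atTop 1] with t ht
  rw [norm_mul, Complex.norm_real, Real.norm_of_nonneg (zero_le_one.trans ht)]
  exact le_mul_of_one_le_left (norm_nonneg _) ht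

theorem LaplaceClass.integral_derivWithin (hh : LaplaceClass C h) {a : ℝ} (ha : 0 < a) :
    ∫ t in Ioi a, derivWithin h (Ici 0) t = -h a := by
  rw [integral_Ioi_of_hasDerivAt_of_tendsto (hh.hasDerivAt ha).continuousAt.continuousWithinAt
    (fun t ht => hh.hasDerivAt (ha.trans ht)) (hh.integrableOn_derivWithin ha)
    hh.tendsto_atTop_zero, zero_sub]

/-- Integration by parts against a bounded measurable function. -/
theorem LaplaceClass.integral_mul_eq (hh : LaplaceClass C h) {F : ℝ → ℂ} {B : ℝ}
    (hF : AEStronglyMeasurable F (volume.restrict (Ioi 0)))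
    (hB : ∀ᵐ t ∂volume.restrict (Ioi (0 : ℝ)), ‖F t‖ ≤ B) :
    IntegrableOn (fun t => h t * F t) (Ioi 0) ∧
      ∫ t in Ioi 0, h t * F t =
        -∫ s in Ioi 0, derivWithin h (Ici 0) s * ∫ t in Ioc 0 s, F t := by
  let ν : Measure ℝ := volume.restrict (Ioi 0)
  let h' := derivWithin h (Ici 0)
  -- Fubini for `h'(s) F(t)` on `t < s`: integrating in `s` first gives `-h(t) F(t)`, in `t` first
  -- `h'(s) ∫_0^s F`. The integral of `|K|` is at most `B ∫ s |h'(s)| ds`.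
  let K : ℝ × ℝ → ℂ := {x | x.1 < x.2}.indicator fun x => h' x.2 * F x.1
  have hmeas : MeasurableSet {x : ℝ × ℝ | x.1 < x.2} :=
    measurableSet_lt measurable_fst measurable_snd
  have hKm : AEStronglyMeasurable K (ν.prod ν) :=
    (hh.aestronglyMeasurable_derivWithin.comp_snd.mul hF.comp_fst).indicator hmeas
  have hKapp : ∀ t s, K (t, s) = (Iio s).indicator (fun t => h' s * F t) t := fun t s => by
    by_cases hts : t < s
    · simp [K, hts]
    · simp [K, hts]
  have hKapp' : ∀ t s, K (t, s) = (Ioi t).indicator (fun s => h' s * F t) s := fun t s => by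
    by_cases hts : t < s
    · simp [K, hts]
    · simp [K, hts]
  have hKi : Integrable K (ν.prod ν) := by
    refine ⟨hKm, ?_⟩
    rw [HasFiniteIntegral, lintegral_prod_symm _ hKm.enorm]
    have hle : ∀ᵐ s ∂ν, ∫⁻ t, ‖K (t, s)‖ₑ ∂ν ≤ ‖(s : ℂ) * h' s‖ₑ * ENNReal.ofReal B := by
      refine ae_restrict_of_forall_mem measurableSet_Ioi fun s hs => ?_
      have hs0 : 0 < s := hs
      calc ∫⁻ t, ‖K (t, s)‖ₑ ∂ν
          ≤ ∫⁻ t, (Iio s).indicator (fun _ => ‖h' s‖ₑ * ENNReal.ofReal B) t ∂ν := by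
            refine lintegral_mono_ae ?_
            filter_upwards [hB] with t ht
            rw [hKapp]
            by_cases hts : t ∈ Iio s
            · rw [indicator_of_mem hts, indicator_of_mem hts, enorm_mul, ← ofReal_norm (F t)]
              gcongr
            · rw [indicator_of_notMem hts, enorm_zero]
              exact zero_le
        _ = ‖h' s‖ₑ * ENNReal.ofReal B * ENNReal.ofReal s := by
            rw [lintegral_indicator_const measurableSet_Iio, Measure.restrict_apply
              measurableSet_Iio, inter_comm, Ioi_inter_Iio, Real.volume_Ioo, sub_zero]
        _ = _ := by
            rw [enorm_mul, ← ofReal_norm (s : ℂ), Complex.norm_real, Real.norm_of_nonneg hs0.le]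
            ring
    refine (lintegral_mono_ae hle).trans_lt ?_
    rw [lintegral_mul_const' _ _ ENNReal.ofReal_ne_top]
    exact ENNReal.mul_lt_top (hh.integral_le.trans_lt ENNReal.coe_lt_top) ENNReal.ofReal_lt_top
  have hleft : ∀ t ∈ Ioi (0 : ℝ), ∫ s, K (t, s) ∂ν = -(h t * F t) := fun t ht => by
    simp_rw [hKapp']
    rw [integral_indicator measurableSet_Ioi, Measure.restrict_restrict measurableSet_Ioi,
      inter_eq_left.2 (Ioi_subset_Ioi (le_of_lt ht)), integral_mul_const,
      hh.integral_derivWithin ht, neg_mul]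
  have hright : ∀ s, ∫ t, K (t, s) ∂ν = h' s * ∫ t in Ioc 0 s, F t := fun s => by
    simp_rw [hKapp]
    rw [integral_indicator measurableSet_Iio, Measure.restrict_restrict measurableSet_Iio,
      inter_comm, Ioi_inter_Iio, integral_const_mul, integral_Ioc_eq_integral_Ioo]
  constructor
  · refine hKi.integral_prod_left.neg.congr ?_
    refine ae_restrict_of_forall_mem measurableSet_Ioi fun t ht => ?_
    simp only [Pi.neg_apply]
    rw [hleft t ht, neg_neg]
  · have hswap := integral_integral_swap (f := fun t s => K (t, s)) hKi
    simp_rw [hright] at hswap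
    rw [setIntegral_congr_fun measurableSet_Ioi hleft, integral_neg] at hswap
    rw [← hswap, neg_neg]

theorem LaplaceClass.integrableOn (hh : LaplaceClass C h) : IntegrableOn h (Ioi 0) := by
  simpa using (hh.integral_mul_eq (F := fun _ => 1) (B := 1) aestronglyMeasurable_const
    (ae_of_all _ fun _ => by simp)).1

end LaplaceClass

/-! ### The maximal inequality -/

section Maximal

variable {X : Type*} [MeasurableSpace X] {μ : Measure X}

theorem isLUB_aeSup [SigmaFinite μ] (S : Set (X →ₘ[μ] ℝ≥0∞)) : IsLUB S (aeSup S) :=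
  (exists_isLUB_aeEqFun S).choose_spec

theorem coeFn_absClass {p : ℝ≥0∞} (f : Lp ℂ p μ) : absClass f =ᵐ[μ] fun x => ‖f x‖ₑ :=
  AEEqFun.coeFn_comp _ _ _

variable [SigmaFinite μ] {L : Lp ℂ 2 μ →ₗ.[ℂ] Lp ℂ 2 μ} {hL : IsPosSelfAdjoint L} {p : ℝ≥0∞}
  [Fact (1 ≤ p)]

theorem enorm_semigroupAverage_le (f : Lp ℂ p μ) {s : ℝ} (hs : 0 < s) :
    ∀ᵐ x ∂μ, ‖semigroupAverage L hL s f x‖ₑ ≤ maximalFunction L hL f x := by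
  have h1 := AEEqFun.coeFn_le.2 ((isLUB_aeSup {g | ∃ s : ℝ, 0 < s ∧
    g = absClass (semigroupAverage L hL s f)}).1 ⟨s, hs, rfl⟩)
  filter_upwards [h1, coeFn_absClass (semigroupAverage L hL s f)] with x hx hx'
  rwa [hx'] at hx

/-- Pairing with `ψ` before estimating means that each `A^s f` is compared with `A^* f` for one
fixed `s`. The null set may depend on `s`, and no joint measurability in `(s, x)` is needed. -/
theorem IsLpContractive.enorm_laplaceOp_le (hcontr : IsLpContractive L hL) {C : ℝ≥0}
    {h : ℝ → ℂ} (hh : LaplaceClass C h) (f : Lp ℂ p μ) :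
    ∀ᵐ x ∂μ, ‖laplaceOp L hL h f x‖ₑ ≤ C * maximalFunction L hL f x := by
  have hp1 : 1 ≤ p := Fact.out
  have hu := Lp.memLp (laplaceOp L hL h f)
  refine ae_enorm_le_of_forall_integral_mul_le hu.1
    (fun s _ hs => hu.integrableOn_of_measure_lt_top hp1 hs) fun ψ hψ => ?_
  have hpq : p.HolderConjugate p.conjExponent := .conjExponent hp1
  have hψq := hψ _ hpq.symm.one_le
  obtain ⟨hFm, B, hFB⟩ := hcontr.integral_heatLp_mul f hpq hψq
  have h1 := (hcontr.hasWeakIntegral_laplaceOp hh.integrableOn f _ hpq ψ hψq).2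
  simp only [integral_smul_lp_mul] at h1
  rw [h1, (hh.integral_mul_eq hFm hFB).2, enorm_neg]
  -- `D` may be infinite; the estimates that follow are made in `[0, ∞]`.
  let D : ℝ≥0∞ := ∫⁻ x, maximalFunction L hL f x * ‖ψ x‖ₑ ∂μ
  have hA : ∀ s ∈ Ioi (0 : ℝ), ‖derivWithin h (Ici 0) s *
      ∫ t in Ioc 0 s, ∫ x, heatLp L hL p t f x * ψ x ∂μ‖ₑ ≤
        ‖(s : ℂ) * derivWithin h (Ici 0) s‖ₑ * D := fun s hs => by
    have h2 := (hcontr.hasWeakIntegral_semigroupAverage hs f _ hpq ψ hψq).2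
    rw [integral_smul_lp_mul] at h2
    rw [← h2, ← mul_assoc, enorm_mul, mul_comm (derivWithin h (Ici 0) s)]
    gcongr
    refine (enorm_integral_le_lintegral_enorm _).trans (lintegral_mono_ae ?_)
    filter_upwards [enorm_semigroupAverage_le f hs] with x hx
    rw [enorm_mul]
    gcongr
  calc _ ≤ ∫⁻ s in Ioi (0 : ℝ), ‖(s : ℂ) * derivWithin h (Ici 0) s‖ₑ * D :=
        (enorm_integral_le_lintegral_enorm _).trans (setLIntegral_mono' measurableSet_Ioi hA)
    _ = (∫⁻ s in Ioi (0 : ℝ), ‖(s : ℂ) * derivWithin h (Ici 0) s‖ₑ) * D :=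
        lintegral_mul_const'' _ hh.integrableOn_mul_derivWithin.1.enorm
    _ ≤ C * D := by
        gcongr
        exact hh.integral_le
    _ = _ := by
        rw [← lintegral_const_mul' _ _ ENNReal.coe_ne_top]
        simp_rw [mul_assoc]

/-- The class of `C A^* f` is an upper bound in the almost-everywhere order, so it dominates the
least one, although the exceptional sets depend on `h`. -/
theorem IsLpContractive.aeSup_laplaceOp_le (hcontr : IsLpContractive L hL) (C : ℝ≥0)
    (f : Lp ℂ p μ) :
    ∀ᵐ x ∂μ, aeSup {g | ∃ h : ℝ → ℂ, LaplaceClass C h ∧ g = absClass (laplaceOp L hL h f)} x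
      ≤ C * maximalFunction L hL f x := by
  have hm : AEStronglyMeasurable (fun x => C * maximalFunction L hL f x) μ :=
    ((maximalFunction L hL f).measurable.const_mul _).aestronglyMeasurable
  have hle := (isLUB_aeSup {g | ∃ h : ℝ → ℂ, LaplaceClass C h ∧
    g = absClass (laplaceOp L hL h f)}).2 (show AEEqFun.mk _ hm ∈ upperBounds _ by
      rintro _ ⟨h, hh, rfl⟩
      rw [← AEEqFun.coeFn_le]
      filter_upwards [coeFn_absClass (laplaceOp L hL h f), AEEqFun.coeFn_mk _ hm,
        hcontr.enorm_laplaceOp_le hh f] with x h1 h2 h3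
      rwa [h1, h2])
  filter_upwards [AEEqFun.coeFn_le.2 hle, AEEqFun.coeFn_mk _ hm] with x h1 h2
  rwa [h2] at h1

end Maximal

theorem mainTheorem10 {X : Type*} [MeasurableSpace X] (μ : Measure X) [SigmaFinite μ]
    (L : Lp ℂ 2 μ →ₗ.[ℂ] Lp ℂ 2 μ) (hL : IsPosSelfAdjoint L) (hcontr : IsLpContractive L hL)
    (p : ℝ≥0∞) [Fact (1 ≤ p)] (C : ℝ≥0) :
    (∀ t : ℝ, 0 < t → IsLpExtension (expNeg L hL t) p (heatLp L hL p t)) ∧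
    ∀ f : Lp ℂ p μ,
      (∀ s : ℝ, 0 < s → HasWeakIntegral (volume.restrict (Ioc 0 s)) (fun t => heatLp L hL p t f)
        ((s : ℂ) • semigroupAverage L hL s f)) ∧
      (∀ h : ℝ → ℂ, LaplaceClass C h →
        HasWeakIntegral (volume.restrict (Ioi 0)) (fun t => h t • heatLp L hL p t f)
          (laplaceOp L hL h f) ∧
        ∀ᵐ x ∂μ, ‖laplaceOp L hL h f x‖ₑ ≤ C * maximalFunction L hL f x) ∧
      ∀ᵐ x ∂μ, aeSup {g | ∃ h : ℝ → ℂ, LaplaceClass C h ∧ g = absClass (laplaceOp L hL h f)} x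
        ≤ C * maximalFunction L hL f x := by
  refine ⟨fun t ht => hcontr.isLpExtension_heatLp ht, fun f => ⟨fun s hs =>
    hcontr.hasWeakIntegral_semigroupAverage hs f, fun h hh =>
    ⟨hcontr.hasWeakIntegral_laplaceOp hh.integrableOn f, hcontr.enorm_laplaceOp_le hh f⟩,
    hcontr.aeSup_laplaceOp_le C f⟩⟩
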